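/- Let $dm(t)=\dfrac{t}{e^{t}-1}\,dt$ on $(0,\infty)$ and let $D_1=\{w\in\mathbb C: |w-1|<1\}$. Let $\mathcal H_0$ be the space of all functions $f:D_1\to\mathbb C$ that are generalized Borel transforms $$f(w)=(\mathcal B[\varphi])(w)=\frac1{w^{2}}\int_0^\infty e^{-t/w}\,e^{t}\,\varphi(t)\,dm(t),\qquad \varphi\in L^2(m).$$ The function $\varphi$ is uniquely determined by $f$ in $L^2(m)$, and $\mathcal H_0$ is a Hilbert space with the inner product $(\mathcal B[\varphi_1],\mathcal B[\varphi_2])=\int_0^\infty\overline{\varphi_1(t)}\,\varphi_2(t)\,dm(t)$. Then the transfer operator of the Farey map, $$(\mathcal P f)(w)=\Big(\frac1{w+1}\Big)^{2}\Big[f\Big(\frac{w}{w+1}\Big)+f\Big(\frac1{w+1}\Big)\Big],\qquad w\in D_1,$$ is a bounded linear operator $\mathcal P:\mathcal H_0\to\mathcal H_0$, and its spectrum is $$\sigma(\mathcal P)=[0,1]\cup S,$$ where $S\subset\mathbb C$ is a finite or countably infinite (possibly empty) set of eigenvalues of $\mathcal P$ of finite (algebraic, hence also geometric) multiplicity. 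-/

import Mathlib

open MeasureTheory

noncomputable section

namespace Farey

/-- The measure `dm(t) = t / (e^t - 1) dt` on `(0, ∞)`. -/
def m : Measure ℝ :=
  (volume.restrict (Set.Ioi 0)).withDensity (fun t => ENNReal.ofReal (t / (Real.exp t - 1)))

/-- The disk `D₁ = {w : |w - 1| < 1} = {w : Re (1 / w) > 1 / 2}`. -/
abbrev D : Set ℂ := Metric.ball 1 1

theorem mem_D_iff (w : ℂ) : w ∈ D ↔ 1 / 2 < (w⁻¹).re := by
  rw [Metric.mem_ball, dist_eq_norm, ← sq_lt_one_iff₀ (norm_nonneg _), Complex.sq_norm,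
    Complex.inv_re]
  by_cases hw : w = 0
  · simp [hw]
  · have h : 0 < Complex.normSq w := Complex.normSq_pos.2 hw
    rw [lt_div_iff₀ h]
    simp only [Complex.normSq_apply, Complex.sub_re, Complex.sub_im, Complex.one_re,
      Complex.one_im]
    constructor <;> intro h <;> nlinarith

theorem inverse_branch_zero_mem (w : D) : (w : ℂ) / (w + 1) ∈ D := by
  have h := (mem_D_iff w).1 w.2
  have hw : (w : ℂ) ≠ 0 := by
    intro h0
    rw [h0] at h
    norm_num at h
  rw [mem_D_iff, inv_div, add_div, div_self hw, Complex.add_re, one_div (w : ℂ), Complex.one_re]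
  linarith

theorem inverse_branch_one_mem (w : D) : 1 / ((w : ℂ) + 1) ∈ D := by
  have h : |((w : ℂ) - 1).re| < 1 :=
    (Complex.abs_re_le_norm _).trans_lt (dist_eq_norm (w : ℂ) 1 ▸ Metric.mem_ball.1 w.2)
  rw [Complex.sub_re, Complex.one_re, abs_lt] at h
  rw [mem_D_iff, one_div ((w : ℂ) + 1), inv_inv, Complex.add_re, Complex.one_re]
  linarith [h.1]

/-- The transfer operator of the Farey map, acting on complex functions on `D₁`:
`P f (w) = (1 / (w + 1))² (f (w / (w + 1)) + f (1 / (w + 1)))`. -/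
def transfer (f : D → ℂ) (w : D) : ℂ :=
  (1 / ((w : ℂ) + 1)) ^ 2 *
    (f ⟨(w : ℂ) / (w + 1), inverse_branch_zero_mem w⟩ +
      f ⟨1 / ((w : ℂ) + 1), inverse_branch_one_mem w⟩)

theorem density_le {t : ℝ} (ht : 0 < t) : t / (Real.exp t - 1) ≤ (1 + t) * Real.exp (-t) := by
  have h1 : t + 1 ≤ Real.exp t := Real.add_one_le_exp t
  have h2 : 0 < Real.exp t - 1 := by linarith
  rw [div_le_iff₀ h2]
  have h3 : Real.exp (-t) * Real.exp t = 1 := by rw [← Real.exp_add]; simp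
  have h4 : 0 < Real.exp (-t) := Real.exp_pos _
  nlinarith

theorem measurable_density :
    Measurable (fun t : ℝ => ENNReal.ofReal (t / (Real.exp t - 1))) := by fun_prop

theorem ae_density_lt_top : ∀ᵐ t ∂(volume.restrict (Set.Ioi (0 : ℝ))),
    ENNReal.ofReal (t / (Real.exp t - 1)) < ⊤ :=
  Filter.Eventually.of_forall fun _ => ENNReal.ofReal_lt_top

/-- The kernel of the generalized Borel transform is square integrable. -/
theorem kernel_memLp (w : D) :
    MemLp (fun t : ℝ => Complex.exp (-t / w) * Complex.exp t) 2 m := by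
  have hm : Continuous (fun t : ℝ => Complex.exp (-t / w) * Complex.exp t) := by fun_prop
  rw [memLp_two_iff_integrable_sq_norm hm.aestronglyMeasurable, m,
    integrable_withDensity_iff measurable_density ae_density_lt_top]
  have hw := (mem_D_iff w).1 w.2
  set a := ((w : ℂ)⁻¹).re with ha
  set c := 2 * a - 1 with hc
  have hc0 : 0 < c := by rw [hc]; linarith
  have hint : IntegrableOn (fun t : ℝ => (1 + 2 / c) * Real.exp (-(c / 2) * t)) (Set.Ioi 0) :=
    (integrableOn_exp_mul_Ioi (by linarith) 0).const_mul _
  refine Integrable.mono' hint ?_ ?_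
  · refine Measurable.aestronglyMeasurable ?_
    exact ((hm.norm.pow 2).measurable).mul measurable_density.ennreal_toReal
  · filter_upwards [ae_restrict_mem measurableSet_Ioi] with t ht
    have ht : 0 < t := ht
    have h2 : 0 < Real.exp t - 1 := by linarith [Real.add_one_le_exp t]
    have hd : 0 ≤ t / (Real.exp t - 1) := by positivity
    have hn : ‖Complex.exp (-t / w) * Complex.exp t‖ ^ 2 = Real.exp (2 * (t - t * a)) := by
      rw [← Complex.exp_add, Complex.norm_exp, ← Real.exp_nat_mul]
      congr 1
      simp [div_eq_mul_inv, ha]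
      ring
    rw [hn, ENNReal.toReal_ofReal hd, Real.norm_of_nonneg (by positivity)]
    have h3 : 1 + t ≤ (1 + 2 / c) * Real.exp (c / 2 * t) := by
      have e1 : 1 ≤ Real.exp (c / 2 * t) := Real.one_le_exp (by positivity)
      have e2 : c / 2 * t ≤ Real.exp (c / 2 * t) := by
        linarith [Real.add_one_le_exp (c / 2 * t)]
      have e3 : t = 2 / c * (c / 2 * t) := by field_simp
      have e4 : 2 / c * (c / 2 * t) ≤ 2 / c * Real.exp (c / 2 * t) := by gcongr
      linarith
    calc Real.exp (2 * (t - t * a)) * (t / (Real.exp t - 1))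
        ≤ Real.exp (2 * (t - t * a)) * ((1 + t) * Real.exp (-t)) := by
          gcongr; exact density_le ht
      _ ≤ Real.exp (2 * (t - t * a)) * (((1 + 2 / c) * Real.exp (c / 2 * t)) * Real.exp (-t)) := by
          gcongr
      _ = (1 + 2 / c) *
            (Real.exp (2 * (t - t * a)) * Real.exp (c / 2 * t) * Real.exp (-t)) := by ring
      _ = (1 + 2 / c) * Real.exp (-(c / 2) * t) := by
          rw [← Real.exp_add, ← Real.exp_add]
          congr 2
          rw [hc]; ring

theorem integrable_kernel_mul (φ : Lp ℂ 2 m) (w : D) :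
    Integrable (fun t : ℝ => Complex.exp (-t / w) * Complex.exp t * φ t) m :=
  (kernel_memLp w).integrable_mul (Lp.memLp φ)

/-- The generalized Borel transform
`B[φ](w) = w⁻² ∫₀^∞ e^{-t/w} e^t φ(t) dm(t)`, `w ∈ D₁`, `φ ∈ L²(m)`. -/
def borel : Lp ℂ 2 m →ₗ[ℂ] (D → ℂ) where
  toFun φ w := 1 / (w : ℂ) ^ 2 * ∫ t : ℝ, Complex.exp (-t / w) * Complex.exp t * φ t ∂m
  map_add' φ ψ := by
    funext w
    rw [Pi.add_apply, ← mul_add,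
      ← integral_add (integrable_kernel_mul φ w) (integrable_kernel_mul ψ w)]
    refine congrArg (fun z : ℂ => 1 / (w : ℂ) ^ 2 * z) (integral_congr_ae ?_)
    filter_upwards [Lp.coeFn_add φ ψ] with t ht
    rw [ht, Pi.add_apply, mul_add]
  map_smul' c φ := by
    funext w
    rw [Pi.smul_apply, smul_eq_mul, RingHom.id_apply, mul_left_comm,
      ← integral_const_mul c]
    refine congrArg (fun z : ℂ => 1 / (w : ℂ) ^ 2 * z) (integral_congr_ae ?_)
    filter_upwards [Lp.coeFn_smul c φ] with t ht
    rw [ht, Pi.smul_apply, smul_eq_mul, mul_left_comm]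

theorem integral_withDensity_ofReal (μ : Measure ℝ) {g : ℝ → ℝ} (hg : AEMeasurable g μ)
    (F : ℝ → ℂ) : ∫ x, F x ∂(μ.withDensity fun x => ENNReal.ofReal (g x)) =
      ∫ x, ((max (g x) 0 : ℝ) : ℂ) * F x ∂μ := by
  rw [integral_withDensity_eq_integral_toReal_smul₀ hg.ennreal_ofReal
    (Filter.Eventually.of_forall fun _ => ENNReal.ofReal_lt_top)]
  refine integral_congr_ae (Filter.Eventually.of_forall fun x => ?_)
  simp only [ENNReal.toReal_ofReal', Complex.real_smul]

/-- An integrable real function with vanishing Fourier transform is zero. -/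
theorem ae_zero_of_fourier_real (μ : Measure ℝ) {g : ℝ → ℝ} (hg : Integrable g μ)
    (h : ∀ ξ : ℝ, ∫ x, (g x : ℂ) * Complex.exp (ξ * x * Complex.I) ∂μ = 0) :
    g =ᵐ[μ] 0 := by
  have hgm := hg.aemeasurable
  have hneg : Integrable (fun x => -g x) μ := hg.neg
  have hgn : AEMeasurable (fun x => -g x) μ := hgm.neg
  have f1 : IsFiniteMeasure (μ.withDensity fun x => ENNReal.ofReal (g x)) :=
    isFiniteMeasure_withDensity_ofReal hg.2
  have f2 : IsFiniteMeasure (μ.withDensity fun x => ENNReal.ofReal (-g x)) :=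
    isFiniteMeasure_withDensity_ofReal hg.neg.2
  have hb : ∀ (k : ℝ → ℝ), Integrable k μ → ∀ ξ : ℝ,
      Integrable (fun x => ((max (k x) 0 : ℝ) : ℂ) * Complex.exp (ξ * x * Complex.I)) μ := by
    intro k hk ξ
    refine Integrable.mul_bdd (c := 1) hk.pos_part.ofReal ?_ ?_
    · exact (by fun_prop : Continuous fun x : ℝ =>
        Complex.exp (ξ * x * Complex.I)).aestronglyMeasurable
    · refine Filter.Eventually.of_forall fun x => ?_
      rw [← Complex.ofReal_mul, Complex.norm_exp_ofReal_mul_I]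
  have heq : (μ.withDensity fun x => ENNReal.ofReal (g x)) =
      μ.withDensity fun x => ENNReal.ofReal (-g x) := by
    refine Measure.ext_of_charFun ?_
    funext ξ
    rw [charFun_apply_real, charFun_apply_real, integral_withDensity_ofReal μ hgm,
      integral_withDensity_ofReal μ hgn, ← sub_eq_zero,
      ← integral_sub (hb g hg ξ) (hb _ hneg ξ), ← h ξ]
    refine integral_congr_ae (Filter.Eventually.of_forall fun x => ?_)
    simp only []
    rw [← sub_mul, ← Complex.ofReal_sub]
    congr 2
    rcases le_total (g x) 0 with hx | hx
    · rw [max_eq_right hx, max_eq_left (by linarith)]; ring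
    · rw [max_eq_left hx, max_eq_right (by linarith)]; ring
  rw [withDensity_eq_iff hgm.ennreal_ofReal hgn.ennreal_ofReal] at heq
  · filter_upwards [heq] with x hx
    rcases le_total (g x) 0 with h0 | h0
    · rw [ENNReal.ofReal_of_nonpos h0] at hx
      have := ENNReal.ofReal_eq_zero.1 hx.symm
      exact le_antisymm h0 (by simpa using this)
    · rw [ENNReal.ofReal_of_nonpos (p := -g x) (by linarith)] at hx
      exact le_antisymm (ENNReal.ofReal_eq_zero.1 hx) h0
  · have := f1.measure_univ_lt_top
    rw [withDensity_apply _ MeasurableSet.univ, Measure.restrict_univ] at this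
    exact this.ne

/-- An integrable complex function with vanishing Fourier transform is zero. -/
theorem ae_zero_of_fourier (μ : Measure ℝ) {g : ℝ → ℂ} (hg : Integrable g μ)
    (h : ∀ ξ : ℝ, ∫ x, g x * Complex.exp (ξ * x * Complex.I) ∂μ = 0) : g =ᵐ[μ] 0 := by
  have hb : ∀ ξ : ℝ, AEStronglyMeasurable (fun x : ℝ => Complex.exp (ξ * x * Complex.I)) μ :=
    fun ξ => (by fun_prop : Continuous fun x : ℝ =>
        Complex.exp (ξ * x * Complex.I)).aestronglyMeasurable
  have hb' : ∀ ξ : ℝ, ∀ᵐ x : ℝ ∂μ, ‖Complex.exp (ξ * x * Complex.I)‖ ≤ 1 := by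
    refine fun ξ => Filter.Eventually.of_forall fun x => ?_
    rw [← Complex.ofReal_mul, Complex.norm_exp_ofReal_mul_I]
  have hgc : Integrable (fun x => (starRingEnd ℂ) (g x)) μ :=
    (LinearIsometryEquiv.integrable_comp_iff (Complex.conjLIE)).2 hg
  have hc : ∀ ξ : ℝ, ∫ x, (starRingEnd ℂ) (g x) * Complex.exp (ξ * x * Complex.I) ∂μ = 0 := by
    intro ξ
    have h1 := congrArg (starRingEnd ℂ) (h (-ξ))
    rw [← integral_conj, map_zero] at h1
    rw [← h1]
    refine integral_congr_ae (Filter.Eventually.of_forall fun x => ?_)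
    simp [← Complex.exp_conj]
  have hre : (fun x => (g x).re) =ᵐ[μ] 0 := by
    refine ae_zero_of_fourier_real μ hg.re fun ξ => ?_
    have e : ∀ x : ℝ, (((g x).re : ℝ) : ℂ) * Complex.exp (ξ * x * Complex.I) =
        (1 / 2) * (g x * Complex.exp (ξ * x * Complex.I) +
          (starRingEnd ℂ) (g x) * Complex.exp (ξ * x * Complex.I)) := by
      intro x
      rw [Complex.re_eq_add_conj]; ring
    simp_rw [e]
    rw [integral_const_mul, integral_add (hg.mul_bdd (hb ξ) (hb' ξ))
      (hgc.mul_bdd (hb ξ) (hb' ξ)), h, hc]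
    simp
  have him : (fun x => (g x).im) =ᵐ[μ] 0 := by
    refine ae_zero_of_fourier_real μ hg.im fun ξ => ?_
    have e : ∀ x : ℝ, (((g x).im : ℝ) : ℂ) * Complex.exp (ξ * x * Complex.I) =
        (1 / (2 * Complex.I)) * (g x * Complex.exp (ξ * x * Complex.I) -
          (starRingEnd ℂ) (g x) * Complex.exp (ξ * x * Complex.I)) := by
      intro x
      rw [Complex.im_eq_sub_conj]; ring
    simp_rw [e]
    rw [integral_const_mul, integral_sub (hg.mul_bdd (hb ξ) (hb' ξ))
      (hgc.mul_bdd (hb ξ) (hb' ξ)), h, hc]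
    simp
  filter_upwards [hre, him] with x h1 h2
  exact Complex.ext h1 h2

theorem borel_injective : Function.Injective borel := by
  rw [injective_iff_map_eq_zero]
  intro φ hφ
  have hD : ∀ ξ : ℝ, (1 - ξ * Complex.I)⁻¹ ∈ D := by
    intro ξ
    rw [mem_D_iff, inv_inv]
    norm_num
  have hne : ∀ ξ : ℝ, (1 - ξ * Complex.I) ≠ 0 := by
    intro ξ h0
    have := congrArg Complex.re h0
    norm_num at this
  have hint : Integrable (fun t => φ t) m := by
    have := integrable_kernel_mul φ ⟨_, hD 0⟩
    refine this.congr (Filter.Eventually.of_forall fun t => ?_)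
    simp [← Complex.exp_add]
  rw [Lp.eq_zero_iff_ae_eq_zero]
  refine ae_zero_of_fourier m hint fun ξ => ?_
  have h1 : borel φ ⟨_, hD ξ⟩ = 0 := by rw [hφ]; rfl
  have h2 : (1 / ((1 - ξ * Complex.I)⁻¹) ^ 2 : ℂ) ≠ 0 :=
    one_div_ne_zero (pow_ne_zero _ (inv_ne_zero (hne ξ)))
  rw [← (mul_eq_zero.1 h1).resolve_left h2]
  refine integral_congr_ae (Filter.Eventually.of_forall fun t => ?_)
  simp only []
  rw [div_inv_eq_mul, ← Complex.exp_add, mul_comm]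
  congr 2
  ring

/-- The space `H₀` of all functions on `D₁` of the form `B[φ]` with `φ ∈ L²(m)`. -/
def H0 : Type := LinearMap.range borel

namespace H0

instance : AddCommGroup H0 := inferInstanceAs (AddCommGroup (LinearMap.range borel))

instance : Module ℂ H0 := inferInstanceAs (Module ℂ (LinearMap.range borel))

instance : CoeFun H0 (fun _ => D → ℂ) := ⟨fun f => f.1⟩

/-- The generalized Borel transform as a linear bijection from `L²(m)` onto `H₀`. -/
def borelEquiv : Lp ℂ 2 m ≃ₗ[ℂ] H0 := LinearEquiv.ofInjective borel borel_injective

instance : NormedAddCommGroup H0 :=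
  NormedAddCommGroup.induced H0 (Lp ℂ 2 m) borelEquiv.symm borelEquiv.symm.injective

/-- The inner product of `H₀`: `(B[φ₁], B[φ₂]) = ∫₀^∞ conj(φ₁) φ₂ dm`. -/
instance : InnerProductSpace ℂ H0 := InnerProductSpace.induced borelEquiv.symm

theorem coe_borelEquiv (φ : Lp ℂ 2 m) : (borelEquiv φ : D → ℂ) = borel φ := rfl

theorem inner_borelEquiv (φ₁ φ₂ : Lp ℂ 2 m) :
    inner ℂ (borelEquiv φ₁) (borelEquiv φ₂) = ∫ t, (starRingEnd ℂ) (φ₁ t) * φ₂ t ∂m := by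
  have h : inner ℂ (borelEquiv φ₁) (borelEquiv φ₂) =
      inner ℂ (borelEquiv.symm (borelEquiv φ₁)) (borelEquiv.symm (borelEquiv φ₂)) := rfl
  rw [h, borelEquiv.symm_apply_apply, borelEquiv.symm_apply_apply, L2.inner_def]
  simp only [RCLike.inner_apply, mul_comm]

theorem norm_borelEquiv (φ : Lp ℂ 2 m) : ‖borelEquiv φ‖ = ‖φ‖ := by
  have h : ‖borelEquiv φ‖ = ‖borelEquiv.symm (borelEquiv φ)‖ := rfl
  rw [h, borelEquiv.symm_apply_apply]

instance : CompleteSpace H0 :=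
  (LinearIsometryEquiv.mk borelEquiv norm_borelEquiv).toIsometryEquiv.completeSpace_iff.1
    inferInstance

end H0

end Farey

end

/-! The Borel transform carries the transfer operator to `transferOp` = M + B²K on L²(m), where M is
multiplication by e^{-t}, B multiplication by √(1 - e^{-t}), and K the integral operator with kernel
J₁(2√(st))/√(st). The branch w/(w+1) gives M because its reciprocal is 1/w + 1 (`borel_expOp`); the
branch 1/(w+1) gives B²K by a Laplace transform of the Bessel function and Fubini
(`borel_sqrtOp_sqrtOp_kernOp`).

The kernel is bounded and m is finite, so K is compact, while M has spectrum [0,1]. Off [0,1] the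
Fredholm alternative leaves only eigenvalues with finite-dimensional eigenspaces
(`hasEigenvalue_add_of_mem_spectrum`, `finiteDimensional_eigenspace_add`).

M + B²K is not symmetric, but M + BKB is, and (M + B²K)B = B(M + BKB). For μ outside [0,1] all
generalized eigenvectors lie in the range of the injective B, so they pull back to the symmetric
operator. Hence there are no Jordan blocks (`maxGenEigenspace_eq_eigenspace`), and separability
leaves countably many eigenvalues (`countable_setOf_hasEigenvalue`).

Conversely, normalized indicators of short intervals (t₀, t₀ + δ) are approximate eigenvectors for
e^{-t₀}, which puts [0,1] in the spectrum (`exp_neg_mem_spectrum`). -/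

noncomputable section

namespace Farey

/-! ### Compact perturbations and symmetrization in an abstract Hilbert space -/

section Abstract

variable {H : Type*} [NormedAddCommGroup H] [InnerProductSpace ℂ H]

/-- On the eigenspace the identity equals μ⁻¹T, hence is compact, and Riesz's theorem applies. -/
theorem finiteDimensional_eigenspace_of_isCompactOperator {T : H →L[ℂ] H}
    (hT : IsCompactOperator T) {μ : ℂ} (hμ : μ ≠ 0) :
    FiniteDimensional ℂ (Module.End.eigenspace (T : Module.End ℂ H) μ) := by
  set V := Module.End.eigenspace (T : Module.End ℂ H) μ
  have hV : ∀ v ∈ V, (T : Module.End ℂ H) v ∈ V := fun v hv => by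
    rw [Module.End.mem_eigenspace_iff.1 hv]; exact V.smul_mem _ hv
  have hcl : IsClosed (V : Set H) := by
    have : (V : Set H) = {v | T v = μ • v} := by
      ext v; exact Module.End.mem_eigenspace_iff
    rw [this]
    exact isClosed_eq T.continuous (continuous_const_smul μ)
  have h := (IsCompactOperator.restrict (f := (T : Module.End ℂ H)) hT hV hcl).smul (μ⁻¹)
  refine FiniteDimensional.of_isCompactOperator_id (𝕜 := ℂ) ?_
  have hid : (id : V → V) = μ⁻¹ • ⇑((T : Module.End ℂ H).restrict hV) := by
    funext v
    apply Subtype.ext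
    have := Module.End.mem_eigenspace_iff.1 v.2
    change (v : H) = μ⁻¹ • (T : Module.End ℂ H) v
    rw [this, smul_smul, inv_mul_cancel₀ hμ, one_smul]
  rw [hid]
  exact h

/-- If `M - μ` is invertible and `K` is compact, then `μ` is either an eigenvalue or a regular
point of `M + K`. -/
theorem hasEigenvalue_add_of_mem_spectrum [CompleteSpace H] {M K : H →L[ℂ] H}
    (hK : IsCompactOperator K) {μ : ℂ} (hM : IsUnit (M - algebraMap ℂ _ μ))
    (hμ : μ ∈ spectrum ℂ (M + K)) :
    Module.End.HasEigenvalue ((M + K : H →L[ℂ] H) : Module.End ℂ H) μ := by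
  obtain ⟨u, hu⟩ := hM
  -- M + K - μ = u(1 + C) with u = M - μ and C compact, so invertibility fails exactly when -1 lies
  -- in the spectrum of C, where it must be an eigenvalue.
  set C : H →L[ℂ] H := (↑u⁻¹ : H →L[ℂ] H) * K with hC
  have hCc : IsCompactOperator C := hK.clm_comp (↑u⁻¹ : H →L[ℂ] H)
  have hfac : M + K - algebraMap ℂ _ μ = u * (1 + C) := by
    rw [mul_add, hC, ← mul_assoc, Units.mul_inv, one_mul, mul_one, hu]; abel
  have h1 : (-1 : ℂ) ∈ spectrum ℂ C := by
    rw [spectrum.mem_iff] at hμ ⊢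
    intro h
    apply hμ
    have e : algebraMap ℂ (H →L[ℂ] H) μ - (M + K) = u * (algebraMap ℂ _ (-1) - C) := by
      rw [← neg_sub, hfac, map_neg, map_one, ← mul_neg]; congr 1; abel
    rw [e]
    exact u.isUnit.mul h
  have h2 := (hCc.hasEigenvalue_iff_mem_spectrum (by norm_num)).2 h1
  obtain ⟨v, hv⟩ := h2.exists_hasEigenvector
  refine Module.End.hasEigenvalue_of_hasEigenvector (x := v) ⟨?_, hv.2⟩
  rw [Module.End.mem_eigenspace_iff]
  have h3 : C v = (-1 : ℂ) • v := Module.End.mem_eigenspace_iff.1 hv.1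
  have h4 : (M + K) v - μ • v = (u : H →L[ℂ] H) (v + C v) :=
    congrArg (fun T : H →L[ℂ] H => T v) hfac
  rw [h3, neg_one_smul, add_neg_cancel, map_zero, sub_eq_zero] at h4
  exact h4

theorem finiteDimensional_eigenspace_add [CompleteSpace H] {M K : H →L[ℂ] H}
    (hK : IsCompactOperator K) {μ : ℂ} (hM : IsUnit (M - algebraMap ℂ _ μ)) :
    FiniteDimensional ℂ
      (Module.End.eigenspace ((M + K : H →L[ℂ] H) : Module.End ℂ H) μ) := by
  obtain ⟨u, hu⟩ := hM
  have hCc : IsCompactOperator ((↑u⁻¹ : H →L[ℂ] H) * K) := hK.clm_comp (↑u⁻¹ : H →L[ℂ] H)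
  have := finiteDimensional_eigenspace_of_isCompactOperator hCc (μ := -1) (by norm_num)
  refine Submodule.finiteDimensional_of_le (S₂ := Module.End.eigenspace
    (((↑u⁻¹ : H →L[ℂ] H) * K : H →L[ℂ] H) : Module.End ℂ H) (-1)) fun v hv => ?_
  rw [Module.End.mem_eigenspace_iff] at hv ⊢
  have hv' : M v + K v = μ • v := hv
  have hKv : K v = -(u : H →L[ℂ] H) v := by
    rw [hu]
    change K v = -(M v - μ • v)
    rw [← hv']; abel
  change (↑u⁻¹ : H →L[ℂ] H) (K v) = _
  rw [hKv, map_neg, neg_one_smul, neg_inj]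
  exact congrArg (fun T : H →L[ℂ] H => T v) u.inv_mul

/-- The constant is the norm of the resolvent. Approximate eigenvectors violate such a bound, which
is how points are later shown to be spectral. -/
theorem exists_norm_le_mul_norm_apply_sub {T : H →L[ℂ] H} {μ : ℂ} (hμ : μ ∉ spectrum ℂ T) :
    ∃ C : ℝ, 0 ≤ C ∧ ∀ x, ‖x‖ ≤ C * ‖T x - μ • x‖ := by
  obtain ⟨u, hu⟩ := spectrum.notMem_iff.1 hμ
  refine ⟨‖(↑u⁻¹ : H →L[ℂ] H)‖, norm_nonneg _, fun x => ?_⟩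
  have h1 : (↑u⁻¹ : H →L[ℂ] H) ((u : H →L[ℂ] H) x) = x :=
    congrArg (fun T : H →L[ℂ] H => T x) u.inv_mul
  have h2 : (u : H →L[ℂ] H) x = μ • x - T x := congrArg (fun T : H →L[ℂ] H => T x) hu
  rw [norm_sub_rev, ← h2]
  nth_rewrite 1 [← h1]
  exact ContinuousLinearMap.le_opNorm _ _

/-- A symmetric operator on a separable space has at most countably many eigenvalues. -/
theorem countable_setOf_hasEigenvalue [TopologicalSpace.SeparableSpace H] {T : Module.End ℂ H}
    (hT : T.IsSymmetric) : {μ : ℂ | T.HasEigenvalue μ}.Countable := by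
  have hex : ∀ μ : {μ : ℂ | T.HasEigenvalue μ}, ∃ v : H, v ∈ T.eigenspace μ ∧ ‖v‖ = 1 := by
    rintro ⟨μ, hμ⟩
    obtain ⟨v, hv⟩ := Module.End.HasEigenvalue.exists_hasEigenvector hμ
    refine ⟨((‖v‖ : ℂ)⁻¹) • v, Submodule.smul_mem _ _ hv.1, ?_⟩
    rw [norm_smul, norm_inv, Complex.norm_real, norm_norm,
      inv_mul_cancel₀ (norm_ne_zero_iff.2 hv.2)]
  choose v hv hv1 using hex
  -- Unit eigenvectors for distinct eigenvalues are orthogonal, hence at distance √2 > 1, so balls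
  -- of radius 1/2 around them are disjoint.
  have hdisj : Pairwise (Function.onFun Disjoint fun μ => Metric.ball (v μ) (1 / 2)) := by
    intro μ ν hμν
    refine Metric.ball_disjoint_ball ?_
    have h0 : inner ℂ (v μ) (v ν) = (0 : ℂ) :=
      hT.orthogonalFamily_eigenspaces (Subtype.coe_injective.ne hμν) ⟨_, hv μ⟩ ⟨_, hv ν⟩
    have h1 := norm_sub_sq (𝕜 := ℂ) (v μ) (v ν)
    rw [h0, hv1, hv1] at h1
    rw [dist_eq_norm]
    norm_num at h1 ⊢
    nlinarith [norm_nonneg (v μ - v ν)]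
  have : Countable {μ : ℂ | T.HasEigenvalue μ} :=
    Pairwise.countable_of_isOpen_disjoint hdisj (fun _ => Metric.isOpen_ball)
      (fun μ => ⟨v μ, Metric.mem_ball_self (by norm_num)⟩)
  exact Set.countable_coe_iff.1 this

variable {M B G : H →L[ℂ] H}

/-- The equation reads (M - μ)v = B(x - BGv), and (M - μ)⁻¹ commutes with B. -/
theorem exists_preimage_of_shift_apply_mem (hMB : Commute M B) {μ : ℂ}
    (hM : IsUnit (M - algebraMap ℂ _ μ)) {v x : H}
    (hv : (M + B * B * G) v - μ • v = B x) : ∃ y, v = B y := by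
  obtain ⟨u, hu⟩ := hM
  have hcomm : Commute (u : H →L[ℂ] H) B := by
    rw [hu]; exact hMB.sub_left (Algebra.commutes μ B)
  have hinv := hcomm.units_inv_left
  have h1 : (u : H →L[ℂ] H) v = B (x - B (G v)) := by
    rw [hu, map_sub, ← hv]
    change M v - μ • v = M v + B (B (G v)) - μ • v - B (B (G v))
    abel
  refine ⟨(↑u⁻¹ : H →L[ℂ] H) (x - B (G v)), ?_⟩
  calc v = (↑u⁻¹ : H →L[ℂ] H) ((u : H →L[ℂ] H) v) :=
        (congrArg (fun T : H →L[ℂ] H => T v) u.inv_mul).symm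
    _ = (↑u⁻¹ : H →L[ℂ] H) (B (x - B (G v))) := by rw [h1]
    _ = B ((↑u⁻¹ : H →L[ℂ] H) (x - B (G v))) :=
        congrArg (fun T : H →L[ℂ] H => T (x - B (G v))) hinv.eq

theorem shift_apply_comp (hMB : Commute M B) (μ : ℂ) (y : H) :
    (M + B * B * G) (B y) - μ • B y = B ((M + B * G * B) y - μ • y) := by
  have h : M (B y) = B (M y) := congrArg (fun T : H →L[ℂ] H => T y) hMB.eq
  change M (B y) + B (B (G (B y))) - μ • B y = B (M y + B (G (B y)) - μ • y)
  rw [h, map_sub, map_add, map_smul]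

/-- An eigenvector is some By by the range lemma; the intertwining relation and injectivity of B
make y an eigenvector of M + BGB. -/
theorem hasEigenvalue_symmetrized (hMB : Commute M B)
    (hB : Function.Injective B) {μ : ℂ} (hM : IsUnit (M - algebraMap ℂ _ μ))
    (hμ : Module.End.HasEigenvalue ((M + B * B * G : H →L[ℂ] H) : Module.End ℂ H) μ) :
    Module.End.HasEigenvalue ((M + B * G * B : H →L[ℂ] H) : Module.End ℂ H) μ := by
  obtain ⟨v, hv⟩ := hμ.exists_hasEigenvector
  have h1 : (M + B * B * G) v - μ • v = 0 := sub_eq_zero.2 (Module.End.mem_eigenspace_iff.1 hv.1)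
  obtain ⟨y, rfl⟩ := exists_preimage_of_shift_apply_mem (x := 0) hMB hM (by rw [h1, map_zero])
  rw [shift_apply_comp hMB, map_eq_zero_iff B hB, sub_eq_zero] at h1
  refine Module.End.hasEigenvalue_of_hasEigenvector (x := y)
    ⟨Module.End.mem_eigenspace_iff.2 h1, fun h => hv.2 (by rw [h, map_zero])⟩

/-- Away from the spectrum of `M`, the operator `M + B²G` has no Jordan blocks. -/
theorem maxGenEigenspace_eq_eigenspace (hMB : Commute M B) (hB : Function.Injective B)
    (hsymm : ((M + B * G * B : H →L[ℂ] H) : Module.End ℂ H).IsSymmetric)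
    {μ : ℂ} (hM : IsUnit (M - algebraMap ℂ _ μ)) :
    Module.End.maxGenEigenspace ((M + B * B * G : H →L[ℂ] H) : Module.End ℂ H) μ =
      Module.End.eigenspace ((M + B * B * G : H →L[ℂ] H) : Module.End ℂ H) μ := by
  set P : Module.End ℂ H := ((M + B * B * G : H →L[ℂ] H) : Module.End ℂ H) with hP
  refine le_antisymm (fun v hv => ?_) ?_
  · obtain ⟨k, hk⟩ := (Module.End.mem_maxGenEigenspace _ _ _).1 hv
    clear hv
    induction k generalizing v with
    | zero =>
      rw [pow_zero] at hk
      rw [show v = 0 from hk]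
      exact Submodule.zero_mem _
    | succ k ih =>
      rw [pow_succ] at hk
      set w := (P - μ • 1) v with hw
      have h1 := Module.End.mem_eigenspace_iff.1 (ih w hk)
      have hw' : w = (M + B * B * G) v - μ • v := rfl
      -- The range lemma applies twice: the eigenvector w is Bx, and then v is By. Cancelling B
      -- moves the chain to T = M + BGB: (T - μ)y = x and (T - μ)x = 0.
      obtain ⟨x, hx⟩ := exists_preimage_of_shift_apply_mem (v := w) (x := 0) hMB hM (by
        rw [map_zero, sub_eq_zero]; exact h1)
      obtain ⟨y, rfl⟩ := exists_preimage_of_shift_apply_mem (x := x) hMB hM (by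
        rw [← hw', hx])
      rw [shift_apply_comp hMB] at hw'
      have hxy : x = (M + B * G * B) y - μ • y := hB (by rw [← hx, hw'])
      have hx0 : (M + B * G * B) x - μ • x = 0 := by
        rw [← map_eq_zero_iff B hB, ← shift_apply_comp hMB, ← hx, sub_eq_zero]
        exact h1
      set T : Module.End ℂ H := ((M + B * G * B : H →L[ℂ] H) : Module.End ℂ H) with hT
      have hTx : T x = μ • x := sub_eq_zero.1 hx0
      have hTy : T y = x + μ • y := by rw [hxy]; exact (sub_add_cancel _ _).symm
      -- If x ≠ 0 then μ is real, and ⟨x, x⟩ = ⟨x, (T - μ)y⟩ = ⟨(T - μ)x, y⟩ = 0.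
      have hxz : x = 0 := by
        by_contra hne
        have hev : T.HasEigenvalue μ := Module.End.hasEigenvalue_of_hasEigenvector
          ⟨Module.End.mem_eigenspace_iff.2 hTx, hne⟩
        have hconj := hsymm.conj_eigenvalue_eq_self hev
        have h2 := hsymm x y
        change inner ℂ (T x) y = inner ℂ x (T y) at h2
        rw [hTx, hTy, inner_add_right, inner_smul_left, inner_smul_right, hconj] at h2
        have h3 : inner ℂ x x = (0 : ℂ) := by linear_combination -h2
        exact hne (inner_self_eq_zero.1 h3)
      rw [Module.End.mem_eigenspace_iff, ← sub_eq_zero]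
      change w = 0
      rw [hx, hxz, map_zero]
  · exact (Module.End.genEigenspace _ _).monotone le_top

end Abstract

/-! ### Bessel series: recurrence, bounds and Laplace transform -/

section Bessel

/-- The terms of the series `∑ (-1)ᵏ xᵏ / (k! (k + n)!)`. -/
def besselTerm (n k : ℕ) (x : ℝ) : ℝ := (-1) ^ k * x ^ k / (k.factorial * (k + n).factorial)

/-- The entire function `∑ (-1)ᵏ xᵏ / (k! (k + n)!) = x^(-n/2) J_n (2 √x)`. -/
def besselFun (n : ℕ) (x : ℝ) : ℝ := ∑' k, besselTerm n k x

theorem norm_besselTerm_le (n k : ℕ) (x : ℝ) : ‖besselTerm n k x‖ ≤ |x| ^ k / k.factorial := by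
  rw [besselTerm, norm_div, norm_mul, norm_pow, norm_neg, norm_one, one_pow, one_mul, norm_pow,
    Real.norm_eq_abs, Real.norm_of_nonneg (by positivity)]
  gcongr
  exact le_mul_of_one_le_right (by positivity) (by exact_mod_cast Nat.factorial_pos _)

theorem summable_besselTerm (n : ℕ) (x : ℝ) : Summable fun k => besselTerm n k x :=
  Summable.of_norm_bounded (Real.summable_pow_div_factorial |x|) fun k => norm_besselTerm_le n k x

theorem hasDerivAt_besselTerm_succ (n k : ℕ) (x : ℝ) :
    HasDerivAt (besselTerm n (k + 1)) (-besselTerm (n + 1) k x) x := by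
  have h := ((hasDerivAt_pow (k + 1) x).const_mul ((-1 : ℝ) ^ (k + 1))).div_const
    ((k + 1).factorial * (k + 1 + n).factorial : ℝ)
  refine h.congr_deriv ?_
  simp only [besselTerm]
  rw [Nat.factorial_succ k, show k + 1 + n = k + (n + 1) by ring]
  push_cast
  have h1 : (k.factorial : ℝ) ≠ 0 := by positivity
  have h2 : ((k + (n + 1)).factorial : ℝ) ≠ 0 := by positivity
  have h3 : (k + 1 : ℝ) ≠ 0 := by positivity
  field_simp
  ring

/-- Termwise differentiation on a ball containing x; the constant term is split off so that the
remaining derivatives are the terms of index n + 1 without a shift. -/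
theorem hasDerivAt_besselFun (n : ℕ) (x : ℝ) :
    HasDerivAt (besselFun n) (-besselFun (n + 1) x) x := by
  have hs : ∀ y, besselFun n y = besselTerm n 0 y + ∑' k, besselTerm n (k + 1) y := fun y =>
    (summable_besselTerm n y).tsum_eq_zero_add
  have hd : HasDerivAt (fun y => ∑' k, besselTerm n (k + 1) y)
      (∑' k, -besselTerm (n + 1) k x) x := by
    refine hasDerivAt_tsum_of_isPreconnected (t := Metric.ball 0 (|x| + 1)) (y₀ := 0)
      (g := fun k y => besselTerm n (k + 1) y) (g' := fun k y => -besselTerm (n + 1) k y)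
      (u := fun k => (|x| + 1) ^ k / k.factorial)
      (Real.summable_pow_div_factorial _) Metric.isOpen_ball
      (convex_ball _ _).isPreconnected (fun k y _ => hasDerivAt_besselTerm_succ n k y)
      (fun k y hy => ?_) (Metric.mem_ball_self (by positivity))
      ((summable_nat_add_iff 1).2 (summable_besselTerm n 0)) ?_
    · rw [norm_neg]
      refine (norm_besselTerm_le _ _ _).trans ?_
      rw [mem_ball_zero_iff, Real.norm_eq_abs] at hy
      gcongr
    · rw [mem_ball_zero_iff, Real.norm_eq_abs]; linarith
  have h0 : HasDerivAt (besselTerm n 0) 0 x := by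
    have : besselTerm n 0 = fun _ => 1 / ((n.factorial : ℝ)) := by
      funext y; simp [besselTerm]
    rw [this]; exact hasDerivAt_const _ _
  have := h0.add hd
  rw [zero_add, tsum_neg] at this
  rw [show besselFun n = fun y => besselTerm n 0 y + ∑' k, besselTerm n (k + 1) y from funext hs]
  exact this

theorem besselTerm_recurrence (n k : ℕ) (x : ℝ) : besselTerm n (k + 1) x =
    (n + 1) * besselTerm (n + 1) (k + 1) x - x * besselTerm (n + 2) k x := by
  simp only [besselTerm]
  rw [show k + 1 + (n + 1) = (k + n + 1) + 1 by ring, show k + 1 + n = k + n + 1 by ring,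
    show k + (n + 2) = (k + n + 1) + 1 by ring, Nat.factorial_succ (k + n + 1),
    Nat.factorial_succ k]
  push_cast
  have h1 : (k.factorial : ℝ) ≠ 0 := by positivity
  have h2 : ((k + n + 1).factorial : ℝ) ≠ 0 := by positivity
  have h3 : (k + 1 : ℝ) ≠ 0 := by positivity
  have h4 : (k + n + 1 + 1 : ℝ) ≠ 0 := by positivity
  field_simp
  ring

theorem besselFun_recurrence (n : ℕ) (x : ℝ) :
    besselFun n x = (n + 1) * besselFun (n + 1) x - x * besselFun (n + 2) x := by
  have e0 : besselTerm n 0 x = (n + 1) * besselTerm (n + 1) 0 x := by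
    simp only [besselTerm, zero_add, Nat.factorial_succ]
    push_cast
    have h1 : (n.factorial : ℝ) ≠ 0 := by positivity
    have h3 : (n + 1 : ℝ) ≠ 0 := by positivity
    field_simp
  have hs1 : Summable fun k => besselTerm (n + 1) (k + 1) x :=
    (summable_nat_add_iff 1).2 (summable_besselTerm (n + 1) x)
  simp only [besselFun]
  rw [(summable_besselTerm n x).tsum_eq_zero_add,
    (summable_besselTerm (n + 1) x).tsum_eq_zero_add, mul_add, e0, add_sub_assoc]
  congr 1
  rw [← tsum_mul_left, ← tsum_mul_left,
    ← (hs1.mul_left _).tsum_sub ((summable_besselTerm (n + 2) x).mul_left _)]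
  exact tsum_congr fun k => besselTerm_recurrence n k x

theorem besselFun_zero (n : ℕ) : besselFun n 0 = 1 / n.factorial := by
  rw [besselFun, tsum_eq_single 0]
  · simp [besselTerm]
  · intro k hk; simp [besselTerm, hk]

theorem continuous_besselFun (n : ℕ) : Continuous (besselFun n) :=
  continuous_iff_continuousAt.2 fun x => (hasDerivAt_besselFun n x).continuousAt

/-- The energy `x y'² + y²` of `y = besselFun n` decreases on `[0, ∞)`. -/
theorem abs_besselFun_le (n : ℕ) {x : ℝ} (hx : 0 ≤ x) : |besselFun n x| ≤ 1 / n.factorial := by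
  set E : ℝ → ℝ := fun y => y * besselFun (n + 1) y ^ 2 + besselFun n y ^ 2 with hE
  -- The recurrence eliminates `besselFun (n + 2)` and the cross terms cancel. The bound then
  -- compares E(x) with E(0) = (1/n!)².
  have hd : ∀ y, HasDerivAt E (-(2 * n + 1) * besselFun (n + 1) y ^ 2) y := by
    intro y
    have h := ((hasDerivAt_id y).mul ((hasDerivAt_besselFun (n + 1) y).pow 2)).add
      ((hasDerivAt_besselFun n y).pow 2)
    refine h.congr_deriv ?_
    have hr := besselFun_recurrence n y
    simp only [id, Pi.pow_apply]
    push_cast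
    linear_combination (-2 * besselFun (n + 1) y) * hr
  have hanti : Antitone E := antitone_of_deriv_nonpos (fun y => (hd y).differentiableAt)
    fun y => by
      rw [(hd y).deriv]
      have : 0 ≤ (2 * n + 1 : ℝ) * besselFun (n + 1) y ^ 2 := by positivity
      linarith
  have h := hanti hx
  simp only [hE, zero_mul, zero_add, besselFun_zero] at h
  refine abs_le_of_sq_le_sq (h.trans' ?_) (by positivity)
  have : 0 ≤ x * besselFun (n + 1) x ^ 2 := by positivity
  linarith

theorem abs_besselFun_sub_le (n : ℕ) {x y : ℝ} (hx : 0 ≤ x) (hy : 0 ≤ y) :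
    |besselFun n x - besselFun n y| ≤ |x - y| := by
  have h := Convex.norm_image_sub_le_of_norm_hasDerivWithin_le (s := Set.Ici (0 : ℝ)) (C := 1)
    (f := besselFun n) (fun z _ => (hasDerivAt_besselFun n z).hasDerivWithinAt)
    (fun z hz => ?_) (convex_Ici 0) (show y ∈ Set.Ici (0 : ℝ) from hy) hx
  · simpa using h
  · rw [norm_neg, Real.norm_eq_abs]
    refine (abs_besselFun_le _ hz).trans ?_
    rw [div_le_one (by positivity)]
    exact_mod_cast Nat.factorial_pos _

theorem integral_exp_mul_pow_real {r : ℝ} (hr : 0 < r) (k : ℕ) :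
    ∫ s in Set.Ioi (0 : ℝ), Real.exp (-r * s) * s ^ k = k.factorial / r ^ (k + 1) := by
  have h := Real.integral_rpow_mul_exp_neg_mul_Ioi (a := k + 1) (by positivity) hr
  rw [Real.Gamma_nat_eq_factorial, add_sub_cancel_right] at h
  have e : ((k : ℝ) + 1) = ((k + 1 : ℕ) : ℝ) := by push_cast; rfl
  rw [e, Real.rpow_natCast, one_div, inv_pow, inv_mul_eq_div] at h
  rw [← h]
  refine setIntegral_congr_fun measurableSet_Ioi fun s _ => ?_
  simp only [Real.rpow_natCast]
  rw [mul_comm, neg_mul]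

theorem integrableOn_exp_mul_pow {r : ℝ} (hr : 0 < r) (k : ℕ) :
    IntegrableOn (fun s => Real.exp (-r * s) * s ^ k) (Set.Ioi (0 : ℝ)) := by
  -- A non-integrable function has integral 0 by convention, whereas the value computed here is
  -- nonzero.
  refine not_imp_comm.1 integral_undef ?_
  rw [integral_exp_mul_pow_real hr]
  positivity

theorem norm_exp_mul_pow {p : ℂ} (k : ℕ) {s : ℝ} (hs : 0 < s) :
    ‖Complex.exp (-p * s) * (s : ℂ) ^ k‖ = Real.exp (-p.re * s) * s ^ k := by
  rw [norm_mul, Complex.norm_exp, norm_pow, Complex.norm_real, Real.norm_of_nonneg hs.le]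
  simp

theorem integrableOn_cexp_mul_pow {p : ℂ} (hp : 0 < p.re) (k : ℕ) :
    IntegrableOn (fun s : ℝ => Complex.exp (-p * s) * (s : ℂ) ^ k) (Set.Ioi (0 : ℝ)) := by
  refine (integrableOn_exp_mul_pow hp k).mono'
    (by fun_prop : Continuous _).aestronglyMeasurable ?_
  filter_upwards [ae_restrict_mem measurableSet_Ioi] with s hs
  exact (norm_exp_mul_pow k hs).le

/-- Integrating the derivative of e^{-ps}s^{k+1} gives (k+1)I_k = p I_{k+1}. The boundary term at
infinity vanishes since the function and its derivative are both integrable. -/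
theorem integral_exp_mul_pow {p : ℂ} (hp : 0 < p.re) (k : ℕ) :
    ∫ s in Set.Ioi (0 : ℝ), Complex.exp (-p * s) * (s : ℂ) ^ k = k.factorial / p ^ (k + 1) := by
  have hp0 : p ≠ 0 := by rintro rfl; simp at hp
  induction k with
  | zero =>
    have h := integral_exp_mul_complex_Ioi (a := -p) (by simpa using hp) 0
    simpa using h
  | succ k ih =>
    have hd : ∀ s : ℝ, HasDerivAt (fun s : ℝ => Complex.exp (-p * s) * (s : ℂ) ^ (k + 1))
        ((k + 1) * (Complex.exp (-p * s) * (s : ℂ) ^ k) -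
          p * (Complex.exp (-p * s) * (s : ℂ) ^ (k + 1))) s := by
      intro s
      have h1 : HasDerivAt (fun z : ℂ => Complex.exp (-p * z) * z ^ (k + 1)) _ (s : ℂ) :=
        (((hasDerivAt_id (s : ℂ)).const_mul (-p)).cexp).mul (hasDerivAt_pow (k + 1) (s : ℂ))
      refine h1.comp_ofReal.congr_deriv ?_
      simp only [id, Nat.add_sub_cancel]
      push_cast
      ring
    have hi : IntegrableOn (fun s : ℝ => (k + 1) * (Complex.exp (-p * s) * (s : ℂ) ^ k) -
          p * (Complex.exp (-p * s) * (s : ℂ) ^ (k + 1))) (Set.Ioi (0 : ℝ)) :=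
      ((integrableOn_cexp_mul_pow hp k).const_mul _).sub
        ((integrableOn_cexp_mul_pow hp (k + 1)).const_mul _)
    have ht := tendsto_zero_of_hasDerivAt_of_integrableOn_Ioi (fun s _ => hd s) hi
      (integrableOn_cexp_mul_pow hp (k + 1))
    have h := integral_Ioi_of_hasDerivAt_of_tendsto
      (hd 0).continuousAt.continuousWithinAt (fun s _ => hd s) hi ht
    rw [integral_sub ((integrableOn_cexp_mul_pow hp k).const_mul _)
        ((integrableOn_cexp_mul_pow hp (k + 1)).const_mul _), integral_const_mul,
        integral_const_mul, ih] at h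
    simp only [Complex.ofReal_zero, ne_eq, Nat.succ_ne_zero, not_false_eq_true, zero_pow,
      mul_zero, sub_zero] at h
    rw [Nat.factorial_succ, eq_div_iff (pow_ne_zero _ hp0)]
    rw [sub_eq_zero] at h
    have hp1 : p ^ (k + 1) ≠ 0 := pow_ne_zero _ hp0
    push_cast
    rw [pow_succ, mul_comm (p ^ (k + 1)) p, ← mul_assoc, mul_comm _ p, ← h]
    field_simp

/-- The Laplace transform of `s ↦ s besselFun 1 (s t)`. -/
theorem integral_exp_mul_besselFun {p : ℂ} (hp : 0 < p.re) {t : ℝ} (ht : 0 ≤ t) :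
    ∫ s in Set.Ioi (0 : ℝ), Complex.exp (-p * s) * (s * besselFun 1 (s * t) : ℝ) =
      Complex.exp (-t / p) / p ^ 2 := by
  have hp0 : p ≠ 0 := by rintro rfl; simp at hp
  set F : ℕ → ℝ → ℂ := fun k s => Complex.exp (-p * s) * (s * besselTerm 1 k (s * t) : ℝ) with hF
  have hFk : ∀ k s, F k s = ((-1) ^ k * t ^ k / (k.factorial * (k + 1).factorial) : ℂ) *
      (Complex.exp (-p * s) * (s : ℂ) ^ (k + 1)) := by
    intro k s
    simp only [hF, besselTerm]
    push_cast
    ring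
  have hnorm : ∀ k, ∀ s ∈ Set.Ioi (0 : ℝ), ‖F k s‖ =
      t ^ k / (k.factorial * (k + 1).factorial) * (Real.exp (-p.re * s) * s ^ (k + 1)) := by
    intro k s hs
    have hs : 0 < s := hs
    rw [hFk, norm_mul, norm_mul, Complex.norm_exp, norm_div, norm_mul, norm_mul]
    simp [abs_of_pos hs, abs_of_nonneg ht]
  have hint : ∀ k, Integrable (F k) (volume.restrict (Set.Ioi 0)) := by
    intro k
    rw [show F k = _ from funext (hFk k)]
    exact (integrableOn_cexp_mul_pow hp (k + 1)).const_mul _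
  -- The (k+1)! from the Gamma integral cancels the one in the Bessel coefficient, leaving an
  -- exponential series in t / Re p; this permits termwise integration.
  have hsum : Summable fun k => ∫ s in Set.Ioi (0 : ℝ), ‖F k s‖ := by
    have e : ∀ k, ∫ s in Set.Ioi (0 : ℝ), ‖F k s‖ =
        1 / p.re ^ 2 * ((t / p.re) ^ k / k.factorial) := by
      intro k
      rw [setIntegral_congr_fun measurableSet_Ioi (hnorm k), integral_const_mul,
        integral_exp_mul_pow_real hp]
      have h1 : (k.factorial : ℝ) ≠ 0 := by positivity
      have h2 : ((k + 1).factorial : ℝ) ≠ 0 := by positivity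
      rw [div_pow]
      field_simp
      ring
    simp_rw [e]
    exact (Real.summable_pow_div_factorial _).mul_left _
  have h := hasSum_integral_of_summable_integral_norm hint hsum
  have hleft : ∀ k, ∫ s in Set.Ioi (0 : ℝ), F k s =
      1 / p ^ 2 * ((-t / p) ^ k / k.factorial) := by
    intro k
    simp_rw [hFk]
    rw [integral_const_mul, integral_exp_mul_pow hp]
    have h1 : (k.factorial : ℂ) ≠ 0 := by exact_mod_cast (Nat.factorial_pos k).ne'
    have h2 : ((k + 1).factorial : ℂ) ≠ 0 := by exact_mod_cast (Nat.factorial_pos (k + 1)).ne'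
    rw [div_pow, neg_pow (t : ℂ)]
    field_simp
    ring
  simp_rw [hleft] at h
  have h' : HasSum (fun k : ℕ => 1 / p ^ 2 * ((-t / p) ^ k / k.factorial))
      (1 / p ^ 2 * Complex.exp (-t / p)) := by
    rw [Complex.exp_eq_exp_ℂ]
    exact (NormedSpace.expSeries_div_hasSum_exp (-t / p : ℂ)).mul_left _
  rw [show Complex.exp (-t / p) / p ^ 2 = 1 / p ^ 2 * Complex.exp (-t / p) by ring,
    ← h.unique h']
  refine integral_congr_ae (Filter.Eventually.of_forall fun s => ?_)
  simp only [hF]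
  rw [tsum_mul_left, ← Complex.ofReal_tsum, tsum_mul_left]
  rfl

end Bessel

/-! ### Finiteness of m and comparison with Lebesgue measure -/

section MeasureFacts

theorem ae_m_pos : ∀ᵐ t ∂m, 0 < t := by
  rw [m]
  exact (withDensity_absolutelyContinuous _ _).ae_le (ae_restrict_mem measurableSet_Ioi)

theorem density_nonneg {t : ℝ} (ht : 0 < t) : 0 ≤ t / (Real.exp t - 1) := by
  have : 0 < Real.exp t - 1 := by linarith [Real.add_one_le_exp t]
  positivity

theorem density_le_one {t : ℝ} (ht : 0 < t) : t / (Real.exp t - 1) ≤ 1 := by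
  have : 0 < Real.exp t - 1 := by linarith [Real.add_one_le_exp t]
  rw [div_le_one this]
  linarith [Real.add_one_le_exp t]

theorem integral_m (f : ℝ → ℂ) :
    ∫ t, f t ∂m = ∫ t in Set.Ioi (0 : ℝ), ((t / (Real.exp t - 1) : ℝ) : ℂ) * f t := by
  rw [m, integral_withDensity_ofReal _ (by fun_prop)]
  refine setIntegral_congr_fun measurableSet_Ioi fun t ht => ?_
  rw [max_eq_left (density_nonneg ht)]

theorem integrable_pow_m (k : ℕ) : Integrable (fun t : ℝ => t ^ k) m := by
  rw [m, integrable_withDensity_iff measurable_density ae_density_lt_top]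
  have h := (integrableOn_exp_mul_pow one_pos k).add (integrableOn_exp_mul_pow one_pos (k + 1))
  refine Integrable.mono' h (Measurable.aestronglyMeasurable
    ((measurable_id.pow_const k).mul measurable_density.ennreal_toReal)) ?_
  filter_upwards [ae_restrict_mem measurableSet_Ioi] with t ht
  have ht : 0 < t := ht
  rw [ENNReal.toReal_ofReal (density_nonneg ht), Real.norm_of_nonneg
    (mul_nonneg (by positivity) (density_nonneg ht))]
  calc t ^ k * (t / (Real.exp t - 1)) ≤ t ^ k * ((1 + t) * Real.exp (-t)) := by
        gcongr; exact density_le ht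
    _ = _ := by simp only [Pi.add_apply]; rw [neg_one_mul]; ring

instance : IsFiniteMeasure m := by
  have h := integrable_pow_m 0
  simp only [pow_zero] at h
  exact (integrable_const_iff_isFiniteMeasure one_ne_zero).1 h

theorem memLp_id_m : MemLp (fun t : ℝ => t) 2 m := by
  rw [memLp_two_iff_integrable_sq (by fun_prop)]
  exact integrable_pow_m 2

theorem m_le_volume (s : Set ℝ) (hs : MeasurableSet s) : m s ≤ volume s := by
  rw [m, withDensity_apply _ hs]
  calc _ ≤ ∫⁻ _ in s, 1 ∂(volume.restrict (Set.Ioi (0 : ℝ))) := by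
        refine lintegral_mono_ae (ae_restrict_of_ae ?_)
        filter_upwards [ae_restrict_mem measurableSet_Ioi] with t ht
        exact ENNReal.ofReal_le_one.2 (density_le_one ht)
    _ ≤ volume s := by
        rw [lintegral_one, Measure.restrict_apply_univ]
        exact Measure.restrict_apply_le _ _

theorem m_Ioo_pos {a b : ℝ} (ha : 0 < a) (hab : a < b) : 0 < m (Set.Ioo a b) := by
  rw [pos_iff_ne_zero]
  intro h0
  rw [m, withDensity_apply_eq_zero measurable_density] at h0
  have hsub : Set.Ioo a b ⊆ {t | ENNReal.ofReal (t / (Real.exp t - 1)) ≠ 0} ∩ Set.Ioo a b := by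
    intro t ht
    refine ⟨?_, ht⟩
    have ht0 : 0 < t := ha.trans ht.1
    have : 0 < Real.exp t - 1 := by linarith [Real.add_one_le_exp t]
    rw [Set.mem_ofPred_eq, Ne, ENNReal.ofReal_eq_zero, not_le]
    positivity
  have h1 := measure_mono_null hsub h0
  rw [Measure.restrict_apply measurableSet_Ioo, Set.inter_eq_self_of_subset_left
    (Set.Ioo_subset_Ioi_self.trans (Set.Ioi_subset_Ioi ha.le)), Real.volume_Ioo,
    ENNReal.ofReal_eq_zero] at h1
  linarith

end MeasureFacts

/-! ### Multiplication operators on L²(m) -/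

section Multiplication

/-- Multiplication by an essentially bounded function, as an operator on `L²(m)`. -/
def mulOp (c : ℝ → ℂ) (hc : MemLp c ⊤ m) : Lp ℂ 2 m →L[ℂ] Lp ℂ 2 m :=
  (ContinuousLinearMap.mul ℂ ℂ).holderL m ⊤ 2 2 (hc.toLp c)

theorem coeFn_mulOp (c : ℝ → ℂ) (hc : MemLp c ⊤ m) (φ : Lp ℂ 2 m) :
    mulOp c hc φ =ᵐ[m] fun t => c t * φ t := by
  filter_upwards [(ContinuousLinearMap.mul ℂ ℂ).coeFn_holder (r := 2) (hc.toLp c) φ,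
    hc.coeFn_toLp] with t h1 h2
  rw [← h2]
  exact h1

theorem mulOp_mul_mulOp {c d e : ℝ → ℂ} (hc : MemLp c ⊤ m) (hd : MemLp d ⊤ m) (he : MemLp e ⊤ m)
    (h : ∀ᵐ t ∂m, c t * d t = e t) : mulOp c hc * mulOp d hd = mulOp e he := by
  ext1 φ
  apply Lp.ext
  change (mulOp c hc (mulOp d hd φ) : ℝ → ℂ) =ᵐ[m] mulOp e he φ
  filter_upwards [coeFn_mulOp c hc (mulOp d hd φ), coeFn_mulOp d hd φ, coeFn_mulOp e he φ, h]
    with t h1 h2 h3 h4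
  rw [h1, h2, h3, ← h4, mul_assoc]

theorem commute_mulOp {c d : ℝ → ℂ} (hc : MemLp c ⊤ m) (hd : MemLp d ⊤ m) :
    Commute (mulOp c hc) (mulOp d hd) := by
  have he : MemLp (fun t => c t * d t) ⊤ m :=
    (ContinuousLinearMap.mul ℂ ℂ).memLp_of_bilin ⊤ hc hd
  have h := mulOp_mul_mulOp hc hd he (Filter.Eventually.of_forall fun _ => rfl)
  have h' := mulOp_mul_mulOp hd hc he (Filter.Eventually.of_forall fun _ => mul_comm _ _)
  exact h.trans h'.symm

theorem inner_mulOp_left {c : ℝ → ℂ} (hc : MemLp c ⊤ m)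
    (hreal : ∀ t, (starRingEnd ℂ) (c t) = c t) (φ ψ : Lp ℂ 2 m) :
    inner ℂ (mulOp c hc φ) ψ = inner ℂ φ (mulOp c hc ψ) := by
  rw [L2.inner_def, L2.inner_def]
  refine integral_congr_ae ?_
  filter_upwards [coeFn_mulOp c hc φ, coeFn_mulOp c hc ψ] with t h1 h2
  rw [h1, h2]
  simp only [RCLike.inner_apply, map_mul, hreal]
  ring

theorem mulOp_injective {c : ℝ → ℂ} (hc : MemLp c ⊤ m) (h0 : ∀ᵐ t ∂m, c t ≠ 0) :
    Function.Injective (mulOp c hc) := by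
  rw [injective_iff_map_eq_zero]
  intro φ hφ
  rw [Lp.eq_zero_iff_ae_eq_zero] at hφ ⊢
  filter_upwards [coeFn_mulOp c hc φ, hφ, h0] with t h1 h2 h3
  rw [h1] at h2
  exact (mul_eq_zero.1 h2).resolve_left h3

/-- The inverse is multiplication by (c - μ)⁻¹, which is essentially bounded by δ⁻¹. -/
theorem isUnit_mulOp_sub {c : ℝ → ℂ} (hc : MemLp c ⊤ m) {μ : ℂ} {δ : ℝ} (hδ : 0 < δ)
    (h : ∀ᵐ t ∂m, δ ≤ ‖c t - μ‖) : IsUnit (mulOp c hc - algebraMap ℂ _ μ) := by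
  have hd : MemLp (fun t => (c t - μ)⁻¹) ⊤ m := by
    refine memLp_top_of_bound ((hc.1.aemeasurable.sub_const μ).inv.aestronglyMeasurable) δ⁻¹ ?_
    filter_upwards [h] with t ht
    rw [norm_inv]
    exact inv_anti₀ hδ ht
  have key : ∀ φ : Lp ℂ 2 m, (mulOp c hc - algebraMap ℂ (Lp ℂ 2 m →L[ℂ] Lp ℂ 2 m) μ) φ =ᵐ[m]
      fun t => (c t - μ) * φ t := by
    intro φ
    change (mulOp c hc φ - μ • φ : Lp ℂ 2 m) =ᵐ[m] _
    filter_upwards [Lp.coeFn_sub (mulOp c hc φ) (μ • φ), coeFn_mulOp c hc φ, Lp.coeFn_smul μ φ]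
      with t h1 h2 h3
    rw [h1, Pi.sub_apply, h2, h3, Pi.smul_apply, smul_eq_mul, sub_mul]
  have hne : ∀ᵐ t ∂m, c t - μ ≠ 0 := by
    filter_upwards [h] with t ht h0
    rw [h0, norm_zero] at ht
    linarith
  refine isUnit_iff_exists.2 ⟨mulOp _ hd, ?_, ?_⟩
  · ext1 φ
    apply Lp.ext
    filter_upwards [key (mulOp _ hd φ), coeFn_mulOp _ hd φ, hne] with t h1 h2 h3
    refine h1.trans ?_
    rw [h2, ← mul_assoc, mul_inv_cancel₀ h3, one_mul]
    rfl
  · ext1 φ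
    apply Lp.ext
    filter_upwards [coeFn_mulOp _ hd ((mulOp c hc - algebraMap ℂ _ μ) φ), key φ, hne]
      with t h1 h2 h3
    refine h1.trans ?_
    rw [h2, ← mul_assoc, inv_mul_cancel₀ h3, one_mul]
    rfl

end Multiplication

/-! ### Compactness of integral operators -/

section KernelCompactness

open ContinuousLinearMap in
/-- An operator `x ↦ (t ↦ B x (f t))` with `f ∈ Lᵖ` is compact if `B` is scalar valued. -/
theorem isCompactOperator_compLpL₂_flip {α E F : Type*} [MeasurableSpace α] {μ : Measure α}
    [NormedAddCommGroup E] [NormedSpace ℂ E] [NormedAddCommGroup F] [NormedSpace ℂ F]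
    {p : ENNReal} [Fact (1 ≤ p)] (hp : p ≠ ⊤) (B : F →L[ℂ] E →L[ℂ] ℂ) (f : Lp E p μ) :
    IsCompactOperator ((compLpL₂ p μ B).flip f) := by
  -- For f = c·1_s the operator is x ↦ B(x, c)·1_s, of rank at most one. Sums and norm limits of
  -- compact operators are compact, which reaches every f in Lᵖ.
  induction f using Lp.induction hp with
  | @indicatorConst c s hs hμs =>
    rw [Lp.simpleFunc.coe_indicatorConst]
    have e : (compLpL₂ p μ B).flip (indicatorConstLp p hs hμs.ne c) =
        (toSpanSingleton ℂ (indicatorConstLp p hs hμs.ne (1 : ℂ))) ∘L (B.flip c) := by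
      ext1 x
      apply Lp.ext
      change ((B x).compLp (indicatorConstLp p hs hμs.ne c) : α → ℂ) =ᵐ[μ]
        (B x c • indicatorConstLp p hs hμs.ne (1 : ℂ) : Lp ℂ p μ)
      filter_upwards [coeFn_compLp (B x) (indicatorConstLp p hs hμs.ne c),
        indicatorConstLp_coeFn (p := p) (hs := hs) (hμs := hμs.ne) (c := c),
        indicatorConstLp_coeFn (p := p) (hs := hs) (hμs := hμs.ne) (c := (1 : ℂ)),
        Lp.coeFn_smul (B x c) (indicatorConstLp p hs hμs.ne (1 : ℂ))] with t h1 h2 h3 h4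
      rw [h1, h2, h4, Pi.smul_apply, h3]
      by_cases ht : t ∈ s
      · simp [Set.indicator_of_mem ht]
      · simp [Set.indicator_of_notMem ht]
    rw [e]
    have hc : IsCompactOperator (B.flip c) := isCompactOperator_of_locallyCompactSpace_dom _
    exact hc.clm_comp (toSpanSingleton ℂ (indicatorConstLp p hs hμs.ne (1 : ℂ)))
  | add hf hg _ ihf ihg =>
    rw [map_add]
    exact ihf.add ihg
  | isClosed =>
    exact isClosed_setOfPred_isCompactOperator.preimage (compLpL₂ p μ B).flip.continuous

end KernelCompactness

/-! ### The compact symmetric operator with Bessel kernel -/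

section BesselKernel

/-- The symmetric kernel `J₁(2√(st)) / √(st)`. -/
def kern (s t : ℝ) : ℝ := besselFun 1 |s * t|

theorem kern_comm (s t : ℝ) : kern s t = kern t s := by rw [kern, kern, mul_comm]

theorem continuous_kern : Continuous fun x : ℝ × ℝ => kern x.1 x.2 :=
  (continuous_besselFun 1).comp (continuous_fst.mul continuous_snd).abs

theorem continuous_kern_right (s : ℝ) : Continuous (kern s) :=
  continuous_kern.comp (Continuous.prodMk_right s)

/-- The absolute value in `kern` makes the Bessel bound, valid on [0, ∞), hold for all s and t; it
changes nothing m-almost everywhere. -/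
theorem norm_kern_le (s t : ℝ) : ‖(kern s t : ℂ)‖ ≤ 1 := by
  rw [Complex.norm_real]
  refine (abs_besselFun_le 1 (abs_nonneg (s * t))).trans_eq ?_
  simp

theorem abs_kern_sub_le (s s' t : ℝ) : |kern s t - kern s' t| ≤ |s - s'| * |t| := by
  refine (abs_besselFun_sub_le 1 (abs_nonneg _) (abs_nonneg _)).trans ?_
  rw [← abs_mul, sub_mul]
  exact abs_abs_sub_abs_le_abs_sub _ _

theorem memLp_kern (s : ℝ) : MemLp (fun t => (kern s t : ℂ)) 2 m :=
  MemLp.of_bound (Complex.continuous_ofReal.comp (continuous_kern_right s)).aestronglyMeasurable 1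
    (Filter.Eventually.of_forall (norm_kern_le s))

/-- The kernel as a curve in `L²(m)`. -/
def kernCurve (s : ℝ) : Lp ℂ 2 m := (memLp_kern s).toLp _

/-- The curve is Lipschitz, with constant the L²(m) norm of t ↦ t. Its continuity supplies the
measurability needed to view it as an element of L²(m; L²(m)). -/
theorem continuous_kernCurve : Continuous kernCurve := by
  refine (LipschitzWith.of_dist_le' (K := ‖(memLp_id_m).toLp _‖) fun s s' => ?_).continuous
  rw [dist_eq_norm, Real.dist_eq, mul_comm]
  refine Lp.norm_le_mul_norm_of_ae_le_mul ?_
  filter_upwards [Lp.coeFn_sub (kernCurve s) (kernCurve s'), (memLp_kern s).coeFn_toLp,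
    (memLp_kern s').coeFn_toLp, memLp_id_m.coeFn_toLp] with t h1 h2 h3 h4
  rw [h1, Pi.sub_apply, kernCurve, kernCurve, h2, h3, h4, ← Complex.ofReal_sub, Complex.norm_real]
  exact abs_kern_sub_le s s' t

theorem norm_kernCurve_le (s : ℝ) :
    ‖kernCurve s‖ ≤ 1 * ‖(memLp_const (1 : ℂ)).toLp (p := 2) (μ := m)‖ := by
  refine Lp.norm_le_mul_norm_of_ae_le_mul ?_
  filter_upwards [(memLp_kern s).coeFn_toLp,
    (memLp_const (1 : ℂ)).coeFn_toLp (p := 2) (μ := m)] with t h1 h2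
  rw [kernCurve, h1, h2, norm_one, mul_one]
  exact norm_kern_le s t

theorem memLp_kernCurve : MemLp kernCurve 2 m :=
  MemLp.of_bound continuous_kernCurve.aestronglyMeasurable _
    (Filter.Eventually.of_forall norm_kernCurve_le)

/-- The integral operator on `L²(m)` with kernel `kern`. -/
def kernOp : Lp ℂ 2 m →L[ℂ] Lp ℂ 2 m :=
  (ContinuousLinearMap.compLpL₂ 2 m
    ((ContinuousLinearMap.mul ℂ ℂ).lpPairing m 2 2)).flip (memLp_kernCurve.toLp _)

theorem isCompactOperator_kernOp : IsCompactOperator kernOp :=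
  isCompactOperator_compLpL₂_flip (by norm_num) _ _

theorem coeFn_kernOp (φ : Lp ℂ 2 m) :
    kernOp φ =ᵐ[m] fun s => ∫ t, (kern s t : ℂ) * φ t ∂m := by
  have h0 : kernOp φ = (((ContinuousLinearMap.mul ℂ ℂ).lpPairing m 2 2) φ).compLp
    (memLp_kernCurve.toLp _) := rfl
  rw [h0]
  filter_upwards [ContinuousLinearMap.coeFn_compLp
    (((ContinuousLinearMap.mul ℂ ℂ).lpPairing m 2 2) φ) (memLp_kernCurve.toLp _),
    memLp_kernCurve.coeFn_toLp] with s h1 h2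
  rw [h1, h2, ContinuousLinearMap.lpPairing_eq_integral]
  refine integral_congr_ae ?_
  filter_upwards [(memLp_kern s).coeFn_toLp] with t h3
  rw [kernCurve, h3, ContinuousLinearMap.mul_apply', mul_comm]

theorem integrable_coeFn (φ : Lp ℂ 2 m) : Integrable φ m :=
  (Lp.memLp φ).integrable (by norm_num)

theorem integrable_prod_kern {μ : Measure ℝ} [SFinite μ] {f g : ℝ → ℂ} (hf : Integrable f μ)
    (hg : Integrable g m) :
    Integrable (fun x : ℝ × ℝ => f x.1 * g x.2 * (kern x.1 x.2 : ℂ)) (μ.prod m) :=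
  (hf.mul_prod hg).mul_bdd (c := 1)
    (Complex.continuous_ofReal.comp continuous_kern).aestronglyMeasurable
    (Filter.Eventually.of_forall fun x => norm_kern_le x.1 x.2)

/-- The kernel is real and symmetric; its boundedness together with m finite justifies Fubini. -/
theorem inner_kernOp_left (φ ψ : Lp ℂ 2 m) :
    inner ℂ (kernOp φ) ψ = inner ℂ φ (kernOp ψ) := by
  have hc : Integrable (fun t => (starRingEnd ℂ) (φ t)) m :=
    (LinearIsometryEquiv.integrable_comp_iff (Complex.conjLIE)).2 (integrable_coeFn φ)
  have hl : inner ℂ (kernOp φ) ψ =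
      ∫ s, ∫ t, ψ s * (starRingEnd ℂ) (φ t) * (kern s t : ℂ) ∂m ∂m := by
    rw [L2.inner_def]
    refine integral_congr_ae ?_
    filter_upwards [coeFn_kernOp φ] with s h1
    rw [h1, RCLike.inner_apply, ← integral_conj, ← integral_const_mul]
    refine integral_congr_ae (Filter.Eventually.of_forall fun t => ?_)
    simp only [map_mul, Complex.conj_ofReal]
    rw [mul_assoc, mul_comm (kern s t : ℂ)]
  have hr : inner ℂ φ (kernOp ψ) =
      ∫ t, ∫ s, ψ s * (starRingEnd ℂ) (φ t) * (kern s t : ℂ) ∂m ∂m := by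
    rw [L2.inner_def]
    refine integral_congr_ae ?_
    filter_upwards [coeFn_kernOp ψ] with t h1
    rw [h1, RCLike.inner_apply, ← integral_mul_const]
    refine integral_congr_ae (Filter.Eventually.of_forall fun s => ?_)
    simp only []
    rw [kern_comm t s]
    ring
  have hi := integrable_prod_kern (integrable_coeFn ψ) hc
  exact hl.trans ((integral_integral_swap hi).trans hr.symm)

/-- An L¹ to L² estimate: unlike the operator norm bound, it makes `kernOp` small on functions
concentrated on small sets. -/
theorem norm_kernOp_le {φ : Lp ℂ 2 m} {C : ℝ} (hC : ∫ t, ‖φ t‖ ∂m ≤ C) :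
    ‖kernOp φ‖ ≤ C * ‖(memLp_const (1 : ℂ)).toLp (p := 2) (μ := m)‖ := by
  refine Lp.norm_le_mul_norm_of_ae_le_mul ?_
  filter_upwards [coeFn_kernOp φ,
    (memLp_const (1 : ℂ)).coeFn_toLp (p := 2) (μ := m)] with s h1 h2
  rw [h1, h2, norm_one, mul_one]
  refine (norm_integral_le_of_norm_le (integrable_coeFn φ).norm
    (Filter.Eventually.of_forall fun t => ?_)).trans hC
  rw [norm_mul]
  exact mul_le_of_le_one_left (norm_nonneg _) (norm_kern_le s t)

end BesselKernel

/-! ### The transfer operator in Borel coordinates -/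

section TransferOperator

theorem exp_neg_le_one_ae : ∀ᵐ t ∂m, ‖(Real.exp (-t) : ℂ)‖ ≤ 1 := by
  filter_upwards [ae_m_pos] with t ht
  rw [Complex.norm_real, Real.norm_of_nonneg (Real.exp_pos _).le]
  exact Real.exp_le_one_iff.2 (by linarith)

theorem memLp_expNeg : MemLp (fun t => (Real.exp (-t) : ℂ)) ⊤ m :=
  memLp_top_of_bound (by fun_prop : Continuous _).aestronglyMeasurable 1 exp_neg_le_one_ae

theorem memLp_sqrt_one_sub : MemLp (fun t => (Real.sqrt (1 - Real.exp (-t)) : ℂ)) ⊤ m := by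
  refine memLp_top_of_bound (by fun_prop : Continuous _).aestronglyMeasurable 1
    (Filter.Eventually.of_forall fun t => ?_)
  rw [Complex.norm_real, Real.norm_of_nonneg (Real.sqrt_nonneg _)]
  exact Real.sqrt_le_one.2 (by linarith [Real.exp_pos (-t)])

theorem memLp_one_sub : MemLp (fun t => ((1 - Real.exp (-t) : ℝ) : ℂ)) ⊤ m := by
  refine memLp_top_of_bound (by fun_prop : Continuous _).aestronglyMeasurable 1 ?_
  filter_upwards [ae_m_pos] with t ht
  have := Real.exp_le_one_iff.2 (show -t ≤ 0 by linarith)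
  rw [Complex.norm_real, Real.norm_of_nonneg (by linarith)]
  linarith [Real.exp_pos (-t)]

/-- Multiplication by `e^{-t}`. -/
def expOp : Lp ℂ 2 m →L[ℂ] Lp ℂ 2 m := mulOp _ memLp_expNeg

/-- Multiplication by `√(1 - e^{-t})`. -/
def sqrtOp : Lp ℂ 2 m →L[ℂ] Lp ℂ 2 m := mulOp _ memLp_sqrt_one_sub

theorem sqrtOp_mul_sqrtOp : sqrtOp * sqrtOp = mulOp _ memLp_one_sub := by
  refine mulOp_mul_mulOp _ _ _ ?_
  filter_upwards [ae_m_pos] with t ht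
  have := Real.exp_le_one_iff.2 (show -t ≤ 0 by linarith)
  rw [← Complex.ofReal_mul, Real.mul_self_sqrt (by linarith)]

theorem sqrtOp_injective : Function.Injective sqrtOp := by
  refine mulOp_injective _ ?_
  filter_upwards [ae_m_pos] with t ht
  have := Real.exp_lt_one_iff.2 (show -t < 0 by linarith)
  exact Complex.ofReal_ne_zero.2 (Real.sqrt_pos.2 (by linarith)).ne'

theorem isSymmetric_symmetrized :
    ((expOp + sqrtOp * kernOp * sqrtOp : Lp ℂ 2 m →L[ℂ] Lp ℂ 2 m) :
      Module.End ℂ (Lp ℂ 2 m)).IsSymmetric := by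
  intro φ ψ
  change inner ℂ (expOp φ + sqrtOp (kernOp (sqrtOp φ))) ψ =
    inner ℂ φ (expOp ψ + sqrtOp (kernOp (sqrtOp ψ)))
  have hs : ∀ φ ψ : Lp ℂ 2 m, inner ℂ (sqrtOp φ) ψ = inner ℂ φ (sqrtOp ψ) :=
    inner_mulOp_left _ fun t => Complex.conj_ofReal _
  have he : ∀ φ ψ : Lp ℂ 2 m, inner ℂ (expOp φ) ψ = inner ℂ φ (expOp ψ) :=
    inner_mulOp_left _ fun t => Complex.conj_ofReal _
  rw [inner_add_left, inner_add_right, he, hs, inner_kernOp_left, hs]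

/-- The operator on `L²(m)` conjugate to the transfer operator. -/
def transferOp : Lp ℂ 2 m →L[ℂ] Lp ℂ 2 m := expOp + sqrtOp * sqrtOp * kernOp

/-- The values e^{-t} lie in [0,1], so they stay at least the positive distance from μ to [0,1] away
from μ. -/
theorem isUnit_expOp_sub {μ : ℂ} (hμ : μ ∉ (fun x : ℝ => (x : ℂ)) '' Set.Icc 0 1) :
    IsUnit (expOp - algebraMap ℂ _ μ) := by
  set I := (fun x : ℝ => (x : ℂ)) '' Set.Icc 0 1
  have hI : IsClosed I := (isCompact_Icc.image Complex.continuous_ofReal).isClosed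
  have hne : I.Nonempty := ⟨_, Set.mem_image_of_mem _ (Set.left_mem_Icc.2 zero_le_one)⟩
  refine isUnit_mulOp_sub _ ((hI.notMem_iff_infDist_pos hne).1 hμ) ?_
  filter_upwards [ae_m_pos] with t ht
  rw [norm_sub_rev, ← dist_eq_norm]
  exact Metric.infDist_le_dist_of_mem
    ⟨Real.exp (-t), ⟨(Real.exp_pos _).le, Real.exp_le_one_iff.2 (by linarith)⟩, rfl⟩

theorem borel_expOp (φ : Lp ℂ 2 m) (w : D) : borel (expOp φ) w =
    (1 / ((w : ℂ) + 1)) ^ 2 * borel φ ⟨(w : ℂ) / (w + 1), inverse_branch_zero_mem w⟩ := by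
  have h := (mem_D_iff w).1 w.2
  have hw : (w : ℂ) ≠ 0 := by
    intro h0
    rw [h0] at h
    norm_num at h
  have hw1 : (w : ℂ) + 1 ≠ 0 := by
    intro h0
    have := inverse_branch_zero_mem w
    rw [h0, div_zero, mem_D_iff, inv_zero] at this
    norm_num at this
  change 1 / (w : ℂ) ^ 2 * ∫ t : ℝ, Complex.exp (-t / w) * Complex.exp t * expOp φ t ∂m =
    (1 / ((w : ℂ) + 1)) ^ 2 * (1 / ((w : ℂ) / (w + 1)) ^ 2 *
      ∫ t : ℝ, Complex.exp (-t / ((w : ℂ) / (w + 1))) * Complex.exp t * φ t ∂m)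
  rw [← mul_assoc]
  congr 1
  · field_simp
  · refine integral_congr_ae ?_
    filter_upwards [coeFn_mulOp _ memLp_expNeg φ] with t ht
    rw [expOp, ht, Complex.ofReal_exp, ← mul_assoc, ← Complex.exp_add, ← Complex.exp_add,
      ← Complex.exp_add]
    congr 2
    push_cast
    field_simp
    ring

/-- The weights combine to e^s(1 - e^{-s}) dm(s) = s ds. The inner integral over s is then the
Laplace transform of s·`besselFun 1 (s * t)` at p = 1/w, equal to w²e^{-tw}, and e^{-tw} =
e^{-t(w+1)}e^t is the Borel kernel at 1/(w+1). -/
theorem borel_sqrtOp_sqrtOp_kernOp (φ : Lp ℂ 2 m) (w : D) :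
    borel (sqrtOp (sqrtOp (kernOp φ))) w =
      (1 / ((w : ℂ) + 1)) ^ 2 * borel φ ⟨1 / ((w : ℂ) + 1), inverse_branch_one_mem w⟩ := by
  have h := (mem_D_iff w).1 w.2
  have hw : (w : ℂ) ≠ 0 := by
    intro h0
    rw [h0] at h
    norm_num at h
  have hw1 : (w : ℂ) + 1 ≠ 0 := by
    intro h0
    have := inverse_branch_zero_mem w
    rw [h0, div_zero, mem_D_iff, inv_zero] at this
    norm_num at this
  have hp : 0 < ((w : ℂ)⁻¹).re := by linarith
  have hss : sqrtOp (sqrtOp (kernOp φ)) = mulOp _ memLp_one_sub (kernOp φ) :=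
    congrArg (fun T : Lp ℂ 2 m →L[ℂ] Lp ℂ 2 m => T (kernOp φ)) sqrtOp_mul_sqrtOp
  have hleft : ∫ t : ℝ, Complex.exp (-t / w) * Complex.exp t * sqrtOp (sqrtOp (kernOp φ)) t ∂m =
      ∫ s in Set.Ioi (0 : ℝ), ∫ t, Complex.exp (-(w : ℂ)⁻¹ * s) * (s : ℂ) ^ 1 * φ t *
        (kern s t : ℂ) ∂m := by
    have e : ∫ t : ℝ, Complex.exp (-t / w) * Complex.exp t * sqrtOp (sqrtOp (kernOp φ)) t ∂m =
        ∫ s : ℝ, Complex.exp (-s / w) * Complex.exp s * (((1 - Real.exp (-s) : ℝ) : ℂ) *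
          ∫ t, (kern s t : ℂ) * φ t ∂m) ∂m := by
      refine integral_congr_ae ?_
      filter_upwards [coeFn_mulOp _ memLp_one_sub (kernOp φ), coeFn_kernOp φ] with s h1 h2
      rw [hss, h1, h2]
    rw [e, integral_m]
    refine setIntegral_congr_fun measurableSet_Ioi fun s hs => ?_
    have hs : 0 < s := hs
    have hpos : Real.exp s - 1 ≠ 0 := by linarith [Real.add_one_le_exp s]
    have e1 : ((s / (Real.exp s - 1) : ℝ) : ℂ) * (Complex.exp s * ((1 - Real.exp (-s) : ℝ) : ℂ)) =
        (s : ℂ) := by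
      rw [← Complex.ofReal_exp, ← Complex.ofReal_mul, ← Complex.ofReal_mul]
      congr 1
      rw [mul_sub, mul_one, ← Real.exp_add, add_neg_cancel, Real.exp_zero]
      exact div_mul_cancel₀ _ hpos
    have e2 : ∫ t, Complex.exp (-(w : ℂ)⁻¹ * s) * (s : ℂ) ^ 1 * φ t * (kern s t : ℂ) ∂m =
        Complex.exp (-s / w) * s * ∫ t, (kern s t : ℂ) * φ t ∂m := by
      rw [← integral_const_mul]
      refine integral_congr_ae (Filter.Eventually.of_forall fun t => ?_)
      simp only []
      rw [pow_one, show -(w : ℂ)⁻¹ * s = -s / w by rw [div_eq_mul_inv]; ring]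
      ring
    rw [e2]
    linear_combination (Complex.exp (-s / w) * ∫ t, (kern s t : ℂ) * φ t ∂m) * e1
  have hright : ∫ t : ℝ, Complex.exp (-t / (1 / ((w : ℂ) + 1))) * Complex.exp t * φ t ∂m =
      ∫ t, 1 / (w : ℂ) ^ 2 * (∫ s in Set.Ioi (0 : ℝ), Complex.exp (-(w : ℂ)⁻¹ * s) *
        (s : ℂ) ^ 1 * φ t * (kern s t : ℂ)) ∂m := by
    refine integral_congr_ae ?_
    filter_upwards [ae_m_pos] with t ht
    have e3 : ∫ s in Set.Ioi (0 : ℝ), Complex.exp (-(w : ℂ)⁻¹ * s) * (s : ℂ) ^ 1 *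
        φ t * (kern s t : ℂ) = φ t * (Complex.exp (-t / (w : ℂ)⁻¹) / ((w : ℂ)⁻¹) ^ 2) := by
      rw [← integral_exp_mul_besselFun hp ht.le, ← integral_const_mul]
      refine setIntegral_congr_fun measurableSet_Ioi fun s hs => ?_
      have hs : 0 < s := hs
      simp only [kern]
      rw [abs_of_pos (mul_pos hs ht)]
      push_cast
      ring
    rw [e3, ← Complex.exp_add]
    have e4 : -(t : ℂ) / (1 / ((w : ℂ) + 1)) + t = -t / (w : ℂ)⁻¹ := by
      rw [one_div, div_inv_eq_mul, div_inv_eq_mul]; ring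
    rw [e4]
    field_simp
  change 1 / (w : ℂ) ^ 2 * ∫ t : ℝ, Complex.exp (-t / w) * Complex.exp t *
      sqrtOp (sqrtOp (kernOp φ)) t ∂m =
    (1 / ((w : ℂ) + 1)) ^ 2 * (1 / (1 / ((w : ℂ) + 1)) ^ 2 *
      ∫ t : ℝ, Complex.exp (-t / (1 / ((w : ℂ) + 1))) * Complex.exp t * φ t ∂m)
  have hi := integrable_prod_kern (integrableOn_cexp_mul_pow hp 1) (integrable_coeFn φ)
  rw [hleft, hright, ← mul_assoc, mul_one_div_cancel (pow_ne_zero _ (one_div_ne_zero hw1)), one_mul,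
    integral_const_mul]
  exact congrArg (1 / (w : ℂ) ^ 2 * ·) (integral_integral_swap hi)

theorem borel_transferOp (φ : Lp ℂ 2 m) : borel (transferOp φ) = transfer (borel φ) := by
  funext w
  have h : transferOp φ = expOp φ + sqrtOp (sqrtOp (kernOp φ)) := rfl
  rw [h, map_add, Pi.add_apply, borel_expOp, borel_sqrtOp_sqrtOp_kernOp, ← mul_add]
  rfl

end TransferOperator

/-! ### The interval [0,1] lies in the spectrum -/

section ContinuousSpectrum

theorem norm_expOp_sub_indicator_le {t₀ : ℝ} (ht₀ : 0 < t₀) (δ : ℝ) :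
    ‖expOp (indicatorConstLp 2 (measurableSet_Ioo (a := t₀) (b := t₀ + δ))
        (measure_ne_top m _) (1 : ℂ)) -
      (Real.exp (-t₀) : ℂ) • indicatorConstLp 2 (measurableSet_Ioo (a := t₀) (b := t₀ + δ))
        (measure_ne_top m _) (1 : ℂ)‖ ≤
    δ * ‖indicatorConstLp 2 (measurableSet_Ioo (a := t₀) (b := t₀ + δ))
        (measure_ne_top m _) (1 : ℂ)‖ := by
  set φ := indicatorConstLp 2 (measurableSet_Ioo (a := t₀) (b := t₀ + δ))
        (measure_ne_top m _) (1 : ℂ) with hφ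
  refine Lp.norm_le_mul_norm_of_ae_le_mul ?_
  filter_upwards [Lp.coeFn_sub (expOp φ) ((Real.exp (-t₀) : ℂ) • φ),
    coeFn_mulOp _ memLp_expNeg φ, Lp.coeFn_smul (Real.exp (-t₀) : ℂ) φ,
    indicatorConstLp_coeFn (p := 2) (hs := measurableSet_Ioo (a := t₀) (b := t₀ + δ))
      (hμs := measure_ne_top m _) (c := (1 : ℂ))] with t h1 h2 h3 h4
  rw [h1, Pi.sub_apply, expOp, h2, h3, Pi.smul_apply, smul_eq_mul, ← sub_mul, norm_mul]
  by_cases ht : t ∈ Set.Ioo t₀ (t₀ + δ)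
  · refine mul_le_mul_of_nonneg_right ?_ (norm_nonneg _)
    rw [← Complex.ofReal_sub, Complex.norm_real, Real.norm_eq_abs, abs_sub_comm, abs_of_nonneg
      (sub_nonneg.2 (Real.exp_le_exp.2 (by linarith [ht.1])))]
    have e1 : Real.exp (-t) = Real.exp (-t₀) * Real.exp (-(t - t₀)) := by
      rw [← Real.exp_add]; congr 1; ring
    have e2 : 1 - (t - t₀) ≤ Real.exp (-(t - t₀)) := by
      linarith [Real.add_one_le_exp (-(t - t₀))]
    have e3 : Real.exp (-t₀) ≤ 1 := Real.exp_le_one_iff.2 (by linarith)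
    have e4 := Real.exp_pos (-t₀)
    have e5 : Real.exp (-t₀) * (t - t₀) ≤ 1 * (t - t₀) :=
      mul_le_mul_of_nonneg_right e3 (by linarith [ht.1])
    have e6 := mul_le_mul_of_nonneg_left e2 e4.le
    rw [e1]
    linarith [ht.2]
  · rw [hφ, h4, Set.indicator_of_notMem ht]
    simp

/-- For an indicator the L¹ norm m(s) is √m(s) times the L² norm. -/
theorem norm_kernOp_indicator_le {s : Set ℝ} (hs : MeasurableSet s) :
    ‖kernOp (indicatorConstLp 2 hs (measure_ne_top m _) (1 : ℂ))‖ ≤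
      √(m.real s) * ‖(memLp_const (1 : ℂ)).toLp (p := 2) (μ := m)‖ *
        ‖indicatorConstLp 2 hs (measure_ne_top m _) (1 : ℂ)‖ := by
  have h1 : ∫ t, ‖indicatorConstLp 2 hs (measure_ne_top m _) (1 : ℂ) t‖ ∂m = m.real s := by
    rw [← integral_indicator_one hs]
    refine integral_congr_ae ?_
    filter_upwards [indicatorConstLp_coeFn (p := 2) (hs := hs)
      (hμs := measure_ne_top m _) (c := (1 : ℂ))] with t h
    rw [h]
    by_cases ht : t ∈ s
    · simp [ht]
    · simp [ht]
  have h2 : ‖indicatorConstLp 2 hs (measure_ne_top m _) (1 : ℂ)‖ = √(m.real s) := by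
    rw [norm_indicatorConstLp (by norm_num) (by norm_num), Real.sqrt_eq_rpow]
    simp
  refine (norm_kernOp_le h1.le).trans_eq ?_
  rw [h2, mul_right_comm, Real.mul_self_sqrt measureReal_nonneg]

/-- On the indicator of (t₀, t₀ + δ) the relative error of M is at most δ and that of the compact
part is O(√δ). A bounded resolvent would force 1 ≤ C·(δ + O(√δ)), which is false as δ → 0. -/
theorem exp_neg_mem_spectrum {t₀ : ℝ} (ht₀ : 0 < t₀) :
    (Real.exp (-t₀) : ℂ) ∈ spectrum ℂ transferOp := by
  set μ : ℂ := (Real.exp (-t₀) : ℂ) with hμ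
  by_contra hspec
  obtain ⟨C, hC, hbound⟩ := exists_norm_le_mul_norm_apply_sub hspec
  set N := ‖(memLp_const (1 : ℂ)).toLp (p := 2) (μ := m)‖
  have hδ : ∀ δ : ℝ, 0 < δ → 1 ≤ C * (δ + ‖sqrtOp * sqrtOp‖ * (√δ * N)) := by
    intro δ hδ
    set φ := indicatorConstLp 2 (measurableSet_Ioo (a := t₀) (b := t₀ + δ))
        (measure_ne_top m _) (1 : ℂ) with hφ
    have hpos : 0 < ‖φ‖ := by
      rw [hφ, norm_indicatorConstLp (by norm_num) (by norm_num), norm_one, one_mul]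
      refine Real.rpow_pos_of_pos ?_ _
      exact ENNReal.toReal_pos (m_Ioo_pos ht₀ (by linarith)).ne' (measure_ne_top m _)
    have hm : m.real (Set.Ioo t₀ (t₀ + δ)) ≤ δ := by
      have := ENNReal.toReal_mono (by simp) (m_le_volume (Set.Ioo t₀ (t₀ + δ)) measurableSet_Ioo)
      rwa [Real.volume_Ioo, ENNReal.toReal_ofReal (by linarith), add_sub_cancel_left] at this
    have h1 : ‖kernOp φ‖ ≤ √δ * N * ‖φ‖ :=
      (norm_kernOp_indicator_le measurableSet_Ioo).trans (by gcongr)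
    have h2 : ‖transferOp φ - μ • φ‖ ≤ (δ + ‖sqrtOp * sqrtOp‖ * (√δ * N)) * ‖φ‖ := by
      have e : transferOp φ - μ • φ = (expOp φ - μ • φ) + (sqrtOp * sqrtOp) (kernOp φ) := by
        change expOp φ + sqrtOp (sqrtOp (kernOp φ)) - μ • φ =
          (expOp φ - μ • φ) + sqrtOp (sqrtOp (kernOp φ))
        abel
      rw [e, add_mul]
      refine (norm_add_le _ _).trans (add_le_add (norm_expOp_sub_indicator_le ht₀ δ) ?_)
      refine (ContinuousLinearMap.le_opNorm _ _).trans ?_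
      rw [mul_assoc]
      gcongr
    have h3 : 1 * ‖φ‖ ≤ C * (δ + ‖sqrtOp * sqrtOp‖ * (√δ * N)) * ‖φ‖ := by
      rw [one_mul, mul_assoc]
      exact (hbound φ).trans (by gcongr)
    exact le_of_mul_le_mul_right h3 hpos
  have hlim : Filter.Tendsto (fun δ : ℝ => C * (δ + ‖sqrtOp * sqrtOp‖ * (√δ * N)))
      (nhdsWithin 0 (Set.Ioi 0)) (nhds 0) := by
    have hc : Continuous fun δ : ℝ => C * (δ + ‖sqrtOp * sqrtOp‖ * (√δ * N)) := by fun_prop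
    have := hc.tendsto 0
    simp only [Real.sqrt_zero, zero_mul, mul_zero, add_zero] at this
    exact this.mono_left nhdsWithin_le_nhds
  have := ge_of_tendsto hlim (Filter.eventually_of_mem self_mem_nhdsWithin hδ)
  linarith

/-- Interior points are e^{-t₀} with t₀ = -log x; the endpoints follow since the spectrum is closed.
-/
theorem image_Icc_subset_spectrum :
    (fun x : ℝ => (x : ℂ)) '' Set.Icc 0 1 ⊆ spectrum ℂ transferOp := by
  have hIoo : Set.Ioo (0 : ℝ) 1 ⊆ (fun x : ℝ => (x : ℂ)) ⁻¹' spectrum ℂ transferOp := by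
    intro x hx
    have h := exp_neg_mem_spectrum (t₀ := -Real.log x) (by linarith [Real.log_neg hx.1 hx.2])
    rwa [neg_neg, Real.exp_log hx.1] at h
  have hcl : IsClosed ((fun x : ℝ => (x : ℂ)) ⁻¹' spectrum ℂ transferOp) :=
    (spectrum.isClosed (𝕜 := ℂ) transferOp).preimage Complex.continuous_ofReal
  rw [Set.image_subset_iff, ← closure_Ioo (zero_ne_one' ℝ)]
  exact hcl.closure_subset_iff.2 hIoo

end ContinuousSpectrum

/-! ### Transport of eigenvalues along a linear equivalence -/

section Conjugation

variable {E F : Type*} [NormedAddCommGroup E] [NormedSpace ℂ E] [NormedAddCommGroup F]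
  [NormedSpace ℂ F]

theorem hasEigenvalue_conj (e : E ≃ₗ[ℂ] F) {T : Module.End ℂ E} {μ : ℂ} (h : T.HasEigenvalue μ) :
    Module.End.HasEigenvalue (e.conj T) μ := by
  obtain ⟨v, hv⟩ := h.exists_hasEigenvector
  refine Module.End.hasEigenvalue_of_hasEigenvector (x := e v)
    ⟨?_, (map_ne_zero_iff e e.injective).2 hv.2⟩
  rw [Module.End.mem_eigenspace_iff, LinearEquiv.conj_apply_apply, e.symm_apply_apply,
    Module.End.mem_eigenspace_iff.1 hv.1, map_smul]

theorem finiteDimensional_maxGenEigenspace_conj (e : E ≃ₗ[ℂ] F) {T : Module.End ℂ E} {μ : ℂ}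
    (h : FiniteDimensional ℂ (T.maxGenEigenspace μ)) :
    FiniteDimensional ℂ (Module.End.maxGenEigenspace (e.conj T) μ) := by
  have : FiniteDimensional ℂ ((T.maxGenEigenspace μ).map (e : E →ₗ[ℂ] F)) := inferInstance
  refine Submodule.finiteDimensional_of_le
    (S₂ := (T.maxGenEigenspace μ).map (e : E →ₗ[ℂ] F)) fun v hv => ?_
  rw [Module.End.mem_maxGenEigenspace] at hv
  obtain ⟨k, hk⟩ := hv
  refine ⟨e.symm v, ?_, e.apply_symm_apply v⟩
  rw [SetLike.mem_coe, Module.End.mem_maxGenEigenspace]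
  refine ⟨k, e.injective ?_⟩
  have hpow : ∀ (j : ℕ) (x : F), ((e.conj T - μ • 1) ^ j) x =
      e (((T - μ • 1) ^ j) (e.symm x)) := by
    intro j
    induction j with
    | zero => intro x; simp
    | succ j ih =>
      intro x
      rw [pow_succ, pow_succ, Module.End.mul_apply, ih, Module.End.mul_apply]
      simp [LinearEquiv.conj_apply_apply]
  rw [← hpow, hk, map_zero]

end Conjugation

/-! ### The spectrum off [0,1] and transfer to H₀ -/

theorem finiteDimensional_maxGenEigenspace_transferOp {μ : ℂ}
    (hμ : μ ∉ (fun x : ℝ => (x : ℂ)) '' Set.Icc 0 1) :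
    FiniteDimensional ℂ
      (Module.End.maxGenEigenspace (transferOp : Module.End ℂ (Lp ℂ 2 m)) μ) := by
  have hM := isUnit_expOp_sub hμ
  have hcomm : Commute expOp sqrtOp := commute_mulOp _ _
  rw [transferOp, maxGenEigenspace_eq_eigenspace hcomm sqrtOp_injective
    isSymmetric_symmetrized hM]
  exact finiteDimensional_eigenspace_add (isCompactOperator_kernOp.clm_comp (sqrtOp * sqrtOp)) hM

theorem hasEigenvalue_transferOp {μ : ℂ} (hμ : μ ∉ (fun x : ℝ => (x : ℂ)) '' Set.Icc 0 1)
    (hs : μ ∈ spectrum ℂ transferOp) :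
    Module.End.HasEigenvalue (transferOp : Module.End ℂ (Lp ℂ 2 m)) μ :=
  hasEigenvalue_add_of_mem_spectrum (isCompactOperator_kernOp.clm_comp (sqrtOp * sqrtOp))
    (isUnit_expOp_sub hμ) hs

/-- Each such point is an eigenvalue of the symmetrized operator, which has only countably many
because L²(m) is separable. -/
theorem countable_spectrum_diff :
    (spectrum ℂ transferOp \ (fun x : ℝ => (x : ℂ)) '' Set.Icc 0 1).Countable := by
  have hsep : TopologicalSpace.SeparableSpace (Lp ℂ 2 m) := by
    have : Fact ((2 : ENNReal) ≠ ⊤) := ⟨by norm_num⟩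
    infer_instance
  refine (countable_setOf_hasEigenvalue isSymmetric_symmetrized).mono fun μ hμ => ?_
  exact hasEigenvalue_symmetrized (commute_mulOp _ _) sqrtOp_injective (isUnit_expOp_sub hμ.2)
    (hasEigenvalue_transferOp hμ.2 hμ.1)

/-- The Borel transform as a continuous linear equivalence. -/
def borelCLE : Lp ℂ 2 m ≃L[ℂ] H0 :=
  (LinearIsometryEquiv.mk H0.borelEquiv H0.norm_borelEquiv).toContinuousLinearEquiv

/-- The transfer operator on `H₀`. -/
def transferCLM : H0 →L[ℂ] H0 :=
  borelCLE.conjContinuousAlgEquiv transferOp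

theorem spectrum_transferCLM : spectrum ℂ transferCLM = spectrum ℂ transferOp :=
  AlgEquiv.spectrum_eq borelCLE.conjContinuousAlgEquiv transferOp

theorem coe_transferCLM_eq_conj : (transferCLM : Module.End ℂ H0) =
    borelCLE.toLinearEquiv.conj (transferOp : Module.End ℂ (Lp ℂ 2 m)) :=
  LinearMap.ext fun _ => rfl

theorem coe_transferCLM (f : H0) : (transferCLM f : D → ℂ) = transfer f := by
  obtain ⟨φ, rfl⟩ := H0.borelEquiv.surjective f
  have h : transferCLM (H0.borelEquiv φ) = H0.borelEquiv (transferOp φ) :=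
    congrArg (fun ψ => H0.borelEquiv (transferOp ψ)) (H0.borelEquiv.symm_apply_apply φ)
  rw [h, H0.coe_borelEquiv, borel_transferOp, H0.coe_borelEquiv]

end Farey

end

theorem theorem3 :
    ∃ P : Farey.H0 →L[ℂ] Farey.H0,
      (∀ f : Farey.H0, (P f : Farey.D → ℂ) = Farey.transfer f) ∧
      ∃ S : Set ℂ, S.Countable ∧
        (∀ μ ∈ S, Module.End.HasEigenvalue (P : Module.End ℂ Farey.H0) μ ∧
          FiniteDimensional ℂ (Module.End.maxGenEigenspace (P : Module.End ℂ Farey.H0) μ)) ∧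
        spectrum ℂ P = (fun x : ℝ => (x : ℂ)) '' Set.Icc 0 1 ∪ S := by
  -- S is the part of the spectrum outside [0,1]; eigenvalues embedded in the interval need no
  -- separate treatment.
  refine ⟨Farey.transferCLM, Farey.coe_transferCLM,
    spectrum ℂ Farey.transferOp \ (fun x : ℝ => (x : ℂ)) '' Set.Icc 0 1,
    Farey.countable_spectrum_diff, fun μ hμ => ⟨?_, ?_⟩, ?_⟩
  · rw [Farey.coe_transferCLM_eq_conj]
    exact Farey.hasEigenvalue_conj _ (Farey.hasEigenvalue_transferOp hμ.2 hμ.1)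
  · rw [Farey.coe_transferCLM_eq_conj]
    exact Farey.finiteDimensional_maxGenEigenspace_conj _
      (Farey.finiteDimensional_maxGenEigenspace_transferOp hμ.2)
  · rw [Farey.spectrum_transferCLM, Set.union_sdiff_cancel Farey.image_Icc_subset_spectrum]
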